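/- Setting. Let $\mathcal P=\{P_1,\dots,P_n\}$ be parties connected by pairwise secure asynchronous channels, $\mathbb F$ a finite field, and $\mathcal Z\subseteq 2^{\mathcal P}$ an adversary structure, i.e. the downward-closed collection of all sets of parties that may be corrupt; let $t=\max\{|Z|:Z\in\mathcal Z\}$. Assume $\mathbb Q^{(3)}(\mathcal P,\mathcal Z)$: no three sets of $\mathcal Z$ cover $\mathcal P$. A computationally unbounded, possibly randomized adversary statically corrupts a set $Z^\star\in\mathcal Z$, acts arbitrarily for the corrupt parties, and schedules all events. It sees every message received by a corrupt party, every input that an honest party gives to the ideal broadcast functionality $\mathcal F_{\mathsf{Acast}}$, and sender, recipient and type of every message between honest parties. "Eventually" refers to executions in which each message between honest parties is eventually delivered, each message held by $\mathcal F_{\mathsf{Acast}}$ is eventually output to all honest parties (all of them get the same message), and, for statements on the output of $\Pi_{\mathsf{Reveal}}$, each honest party is eventually asked to run $\Pi_{\mathsf{Reveal}}$. "$t$-degree" means degree at most $t$; malformed messages are ignored. Let $S,I,R\in\mathcal P$ be the signer, intermediary and receiver, and $s\in\mathbb F$ the input of $S$. Protocol $\Pi_{\mathsf{Auth}}$. (1)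 $S$ picks a uniformly random $t$-degree $F(x)$ with $F(0)=s$, a uniformly random $t$-degree $M(x)$, and independent uniform $\alpha_1,\dots,\alpha_n\in\mathbb F\setminus\{0\}$. It sends $(F,M)$ to $I$ and $(\alpha_j,v_j,m_j)=(\alpha_j,F(\alpha_j),M(\alpha_j))$ to each $P_j$. (2) Each $P_j$, on receiving its point from $S$, sends $\mathsf{Received}$ to $I$. (3) When $I$ holds $(F,M)$ and has received $\mathsf{Received}$ from a set $\mathcal{SV}$ with $\mathcal P\setminus\mathcal{SV}\in\mathcal Z$, it picks a uniform $d\in\mathbb F\setminus\{0\}$ and broadcasts $(d,B,\mathcal{SV})$ with $B=dF+M$ through $\mathcal F_{\mathsf{Acast}}$. (4) On obtaining $(d,B,\mathcal{SV})$, $S$ checks that $B$ is $t$-degree, $\mathcal P\setminus\mathcal{SV}\in\mathcal Z$, and $dv_j+m_j=B(\alpha_j)$ for all $P_j\in\mathcal{SV}$. It broadcasts $\mathsf{OK}$ if so and $(\mathsf{NOK},s)$ otherwise. (5) A party sets $\mathsf{authCompleted}=1$ once it has obtained both broadcasts. If $S$ broadcast $(\mathsf{NOK},s)$, the party sets $\mathsf{ICSig}:=s$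 (publicly); if $S$ broadcast $\mathsf{OK}$, only $I$ sets $\mathsf{ICSig}:=F$. Protocol $\Pi_{\mathsf{Reveal}}$ (run by parties with $\mathsf{authCompleted}=1$). If $\mathsf{ICSig}$ was not set publicly, $I$ sends $F$ to $R$ and every $P_j\in\mathcal{SV}$ sends $(\alpha_j,v_j,m_j)$ to $R$. If $\mathsf{ICSig}$ was publicly set to $s$, $R$ outputs $s$. Otherwise $R$ waits for a $t$-degree polynomial $F$ from $I$, accepts a point $(\alpha_j,v_j,m_j)$ from $P_j\in\mathcal{SV}$ if $v_j=F(\alpha_j)$ or $B(\alpha_j)\ne dv_j+m_j$, and outputs $F(0)$ once the points of all parties in some $\mathcal{SV}'\subseteq\mathcal{SV}$ with $\mathcal{SV}\setminus\mathcal{SV}'\in\mathcal Z$ have been accepted. Statement. Put $\epsilon_{\mathsf{AICP}}=\frac{nt}{|\mathbb F|-1}$. Probabilities are over the coins of the honest parties, for every fixed value of the adversary's random tape. - Correctness: if $S,I,R$ are honest, then each honest party eventually sets $\mathsf{authCompleted}=1$ during $\Pi_{\mathsf{Auth}}$, and $R$ eventually outputs $s$ during $\Pi_{\mathsf{Reveal}}$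 (with probability $1$). - Privacy: if $S,I,R$ are honest, then the distribution of the adversary's view throughout $\Pi_{\mathsf{Auth}}$ and $\Pi_{\mathsf{Reveal}}$ is independent of $s$ (exactly). - Unforgeability: if $S,R$ are honest and $I$ is corrupt, then the probability that $R$ outputs some $s'\ne s$ during $\Pi_{\mathsf{Reveal}}$ is at most $\epsilon_{\mathsf{AICP}}$. - Non-repudiation: if $S$ is corrupt and $I,R$ are honest, then, except with probability at most $\epsilon_{\mathsf{AICP}}$, if $I$ sets $\mathsf{ICSig}$ during $\Pi_{\mathsf{Auth}}$, then $R$ eventually outputs during $\Pi_{\mathsf{Reveal}}$ the value it stands for ($F(0)$ if $\mathsf{ICSig}=F$; the announced value if it was set publicly). - Communication: in every execution the honest parties send $O(n\log|\mathbb F|)$ bits on the channels during $\Pi_{\mathsf{Auth}}$ and make $O(1)$ calls to $\mathcal F_{\mathsf{Acast}}$, with messages of $O(n\log|\mathbb F|)$ bits; during $\Pi_{\mathsf{Reveal}}$ they send $O(n\log|\mathbb F|)$ bits. The implied constants are absolute. -/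

import Mathlib

open Polynomial

namespace AICP

universe u

/-! ### Adversary structures -/

/-- The condition `Q^(k)(A, Z)`: no `k` sets of `Z` cover `A`. -/
def QCond {n : ℕ} (k : ℕ) (A : Finset (Fin n)) (Z : Finset (Finset (Fin n))) : Prop :=
  ∀ f : Fin k → Finset (Fin n), (∀ i, f i ∈ Z) → ¬ A ⊆ Finset.univ.biUnion f

/-- The public parameters of one session: the adversary structure `Z` over the `n` parties, the
signer `S`, the intermediary `I` and the receiver `R` (all `n` parties act as verifiers). -/
structure Session (n : ℕ) where
  Z : Finset (Finset (Fin n))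
  S : Fin n
  I : Fin n
  R : Fin n

/-- `t`, the largest cardinality of a set in the adversary structure. -/
def Session.t {n : ℕ} (P : Session n) : ℕ := P.Z.sup Finset.card

/-! ### Messages -/

/-- A verification point `(α, v, m)`. -/
structure Point (F : Type u) where
  α : F
  v : F
  m : F

/-- Messages on the pairwise channels. (The session identifier is fixed, and the sender of a
message is known to its recipient, the channels being authenticated.) -/
inductive Msg (F : Type u) [Field F] where
  | authPoly (f g : F[X])
  | authPoint (p : Point F)
  | received
  | revealPoly (f : F[X])
  | revealPoint (p : Point F)

inductive Kind where
  | authPoly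
  | authPoint
  | received
  | revealPoly
  | revealPoint

def Msg.kind {F : Type u} [Field F] : Msg F → Kind
  | .authPoly _ _ => .authPoly
  | .authPoint _ => .authPoint
  | .received => .received
  | .revealPoly _ => .revealPoly
  | .revealPoint _ => .revealPoint

/-- The kinds of messages that belong to the authentication protocol; the others belong to the
revelation protocol. -/
def Kind.IsAuth : Kind → Prop
  | .authPoly => True
  | .authPoint => True
  | .received => True
  | .revealPoly => False
  | .revealPoint => False

/-- The broadcast `(d, B, SV)` of the intermediary. -/
structure Masked (n : ℕ) (F : Type u) [Field F] where
  d : F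
  B : F[X]
  SV : Finset (Fin n)

/-- The broadcast of the signer: `OK`, or `NOK` together with the secret. -/
inductive Verdict (F : Type u) where
  | ok
  | nok (s : F)

/-- Messages sent through the broadcast functionality. The two constructors are its two
instances, with the intermediary, resp. the signer, as the sender. -/
inductive Cast (n : ℕ) (F : Type u) [Field F] where
  | masked (m : Masked n F)
  | verdict (v : Verdict F)

/-- What is recorded as `ICSig(S, I, R, s)`: either the public value announced by the signer, or
the signing polynomial (at the intermediary only). -/
inductive ICSig (F : Type u) [Field F] where
  | secret (s : F)
  | poly (f : F[X])

/-- The value that an IC-signature is a signature on. -/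
def ICSig.value {F : Type u} [Field F] : ICSig F → F
  | .secret s => s
  | .poly f => f.eval 0

/-! ### Coins of the honest parties -/

/-- The random coins used by the protocol: the non-constant coefficients of the signing polynomial,
the coefficients of the masking polynomial, the nonzero evaluation points (all of these are used by
the signer), and the nonzero combiner (used by the intermediary). -/
abbrev Coins (n t : ℕ) (F : Type u) [Field F] : Type u :=
  (Fin t → F) × (Fin (t + 1) → F) × (Fin n → Fˣ) × Fˣ

section coins

variable {n t : ℕ} {F : Type u} [Field F]

/-- The signing polynomial: degree at most `t`, constant term `s`. -/
noncomputable def signPoly (s : F) (c : Coins n t F) : F[X] :=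
  C s + ∑ i : Fin t, C (c.1 i) * X ^ ((i : ℕ) + 1)

/-- The masking polynomial, of degree at most `t`. -/
noncomputable def maskPoly (c : Coins n t F) : F[X] :=
  ∑ i : Fin (t + 1), C (c.2.1 i) * X ^ (i : ℕ)

/-- The verification point that an honest signer gives to party `j`. -/
noncomputable def verPoint (s : F) (c : Coins n t F) (j : Fin n) : Point F :=
  ⟨(c.2.2.1 j : F), (signPoly s c).eval (c.2.2.1 j : F), (maskPoly c).eval (c.2.2.1 j : F)⟩

/-- The combiner picked by an honest intermediary. -/
def combiner (c : Coins n t F) : F := (c.2.2.2 : F)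

end coins

/-- The coins are uniformly distributed. -/
noncomputable def coinDist (n t : ℕ) (F : Type u) [Field F] [Fintype F] [DecidableEq F] :
    PMF (Coins n t F) :=
  PMF.uniformOfFintype (Coins n t F)

/-- The probability, over the coins of the honest parties, of an event. -/
noncomputable def prob {n t : ℕ} {F : Type u} [Field F] [Fintype F] [DecidableEq F]
    (E : Set (Coins n t F)) : ENNReal :=
  (coinDist n t F).toOuterMeasure E

/-! ### The program of an honest party -/

/-- The local state of an honest party.
* `polys`: the pair of polynomials received from the signer (used at the intermediary);
* `point`: the verification point received from the signer;
* `confirmed`: the parties that confirmed receipt of their point (used at the intermediary);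
* `masked`, `verdict`: the outputs obtained from the two broadcast instances;
* `revealing`: the party has been asked to take part in the revelation protocol;
* `revPoly`, `revPoint`: what has been revealed to this party (used at the receiver);
* `output`: the output of the revelation protocol (used at the receiver);
* the remaining fields record which one-time steps have been carried out. -/
structure PState (n : ℕ) (F : Type u) [Field F] where
  polys : Option (F[X] × F[X])
  point : Option (Point F)
  confirmed : Finset (Fin n)
  masked : Option (Masked n F)
  verdict : Option (Verdict F)
  revealing : Prop
  revPoly : Option F[X]
  revPoint : Fin n → Option (Point F)
  output : Option F
  announced : Prop
  judged : Prop
  polySent : Prop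
  pointSent : Prop

def PState.initial (n : ℕ) (F : Type u) [Field F] : PState n F :=
  ⟨none, none, ∅, none, none, False, none, fun _ => none, none, False, False, False, False⟩

/-- What a party emits in a step: a message on a channel, or an input to the broadcast
functionality. -/
inductive Out (n : ℕ) (F : Type u) [Field F] where
  | send (dst : Fin n) (m : Msg F)
  | cast (b : Cast n F)

section party

variable {n : ℕ} {F : Type u} [Field F]

/-- The variable `authCompleted` of a party has been set to `1`: it has obtained the outputs of
both broadcast instances. -/
def PState.AuthCompleted (st : PState n F) : Prop :=
  st.masked.isSome ∧ st.verdict.isSome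

/-- The value of `ICSig(S, I, R, s)` held by party `i`, if it has been set. -/
def PState.icSig (P : Session n) (i : Fin n) (st : PState n F) : Option (ICSig F) :=
  match st.masked, st.verdict with
  | some _, some (.nok s) => some (.secret s)
  | some _, some .ok => if i = P.I then st.polys.map (fun q => .poly q.1) else none
  | _, _ => none

open Classical in
/-- Reception of the message `m` from `src` by party `i`. Only the first message of each type from
the relevant sender counts, and polynomials of degree larger than `t` are ignored. -/
noncomputable def receive (P : Session n) (i src : Fin n) (m : Msg F) (st : PState n F) :
    PState n F × List (Out n F) :=
  match m with
  | .authPoly f g =>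
      if i = P.I ∧ src = P.S ∧ st.polys = none ∧ f.natDegree ≤ P.t ∧ g.natDegree ≤ P.t then
        ({ st with polys := some (f, g) }, [])
      else (st, [])
  | .authPoint p =>
      if src = P.S ∧ st.point = none then
        ({ st with point := some p }, [.send P.I .received])
      else (st, [])
  | .received =>
      if i = P.I then ({ st with confirmed := insert src st.confirmed }, []) else (st, [])
  | .revealPoly f =>
      if i = P.R ∧ src = P.I ∧ st.revPoly = none ∧ f.natDegree ≤ P.t then
        ({ st with revPoly := some f }, [])
      else (st, [])
  | .revealPoint p =>
      if i = P.R ∧ st.revPoint src = none then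
        ({ st with revPoint := Function.update st.revPoint src (some p) }, [])
      else (st, [])

open Classical in
/-- Announcing the masked polynomial and the set of supporting verifiers. -/
noncomputable def announce (P : Session n) (c : Coins n P.t F) (i : Fin n) (st : PState n F) :
    PState n F × List (Out n F) :=
  match st.polys with
  | some (f, g) =>
      if i = P.I ∧ ¬ st.announced ∧ Finset.univ \ st.confirmed ∈ P.Z then
        ({ st with announced := True },
          [.cast (.masked ⟨combiner c, C (combiner c) * f + g, st.confirmed⟩)])
      else (st, [])
  | none => (st, [])

/-- The check that the signer performs on the broadcast of the intermediary. -/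
def Valid (P : Session n) (s : F) (c : Coins n P.t F) (b : Masked n F) : Prop :=
  b.B.natDegree ≤ P.t ∧ Finset.univ \ b.SV ∈ P.Z ∧
    ∀ j ∈ b.SV, b.d * (verPoint s c j).v + (verPoint s c j).m = b.B.eval (verPoint s c j).α

open Classical in
/-- Announcing the validity of the masked polynomial. -/
noncomputable def judge (P : Session n) (s : F) (c : Coins n P.t F) (i : Fin n)
    (st : PState n F) : PState n F × List (Out n F) :=
  match st.masked with
  | some b =>
      if i = P.S ∧ ¬ st.judged then
        ({ st with judged := True },
          [.cast (.verdict (if Valid P s c b then .ok else .nok s))])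
      else (st, [])
  | none => (st, [])

open Classical in
/-- The intermediary reveals the signing polynomial to the receiver. -/
noncomputable def sendPoly (P : Session n) (i : Fin n) (st : PState n F) :
    PState n F × List (Out n F) :=
  match st.icSig P i with
  | some (.poly f) =>
      if i = P.I ∧ st.revealing ∧ ¬ st.polySent then
        ({ st with polySent := True }, [.send P.R (.revealPoly f)])
      else (st, [])
  | _ => (st, [])

open Classical in
/-- A supporting verifier reveals its verification point to the receiver. -/
noncomputable def sendPoint (P : Session n) (i : Fin n) (st : PState n F) :
    PState n F × List (Out n F) :=
  match st.masked, st.verdict, st.point with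
  | some b, some .ok, some p =>
      if i ∈ b.SV ∧ st.revealing ∧ ¬ st.pointSent then
        ({ st with pointSent := True }, [.send P.R (.revealPoint p)])
      else (st, [])
  | _, _, _ => (st, [])

/-- Acceptance of a revealed verification point with respect to the broadcast `b` and the revealed
polynomial `f`. -/
def Accepts (b : Masked n F) (f : F[X]) (p : Point F) : Prop :=
  p.v = f.eval p.α ∨ b.B.eval p.α ≠ b.d * p.v + p.m

/-- There is a set `A` of supporting verifiers, all of whose revealed points are accepted, such that
`SV \ A` belongs to the adversary structure. -/
def EnoughAccepted (P : Session n) (b : Masked n F) (f : F[X]) (q : Fin n → Option (Point F)) :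
    Prop :=
  ∃ A ⊆ b.SV, b.SV \ A ∈ P.Z ∧ ∀ j ∈ A, ∃ p, q j = some p ∧ Accepts b f p

open Classical in
/-- The receiver accepts the IC-signature and produces its output. -/
noncomputable def decideOutput (P : Session n) (i : Fin n) (st : PState n F) :
    PState n F × List (Out n F) :=
  if i = P.R ∧ st.revealing ∧ st.output = none then
    match st.masked, st.verdict, st.revPoly with
    | some _, some (.nok s), _ => ({ st with output := some s }, [])
    | some b, some .ok, some f =>
        if EnoughAccepted P b f st.revPoint then
          ({ st with output := some (f.eval 0) }, [])
        else (st, [])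
    | _, _, _ => (st, [])
  else (st, [])

/-- One rule after another, collecting what they emit. -/
def andThen (x : PState n F × List (Out n F)) (r : PState n F → PState n F × List (Out n F)) :
    PState n F × List (Out n F) :=
  match r x.1 with
  | (st, o) => (st, x.2 ++ o)

/-- The steps a party carries out, as soon as they are enabled, after every event at this party. -/
noncomputable def react (P : Session n) (s : F) (c : Coins n P.t F) (i : Fin n)
    (x : PState n F × List (Out n F)) : PState n F × List (Out n F) :=
  andThen (andThen (andThen (andThen (andThen x
    (announce P c i)) (judge P s c i)) (sendPoly P i)) (sendPoint P i)) (decideOutput P i)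

/-- What an honest signer sends at the beginning. -/
noncomputable def distribute (P : Session n) (s : F) (c : Coins n P.t F) : List (Out n F) :=
  .send P.I (.authPoly (signPoly s c) (maskPoly c)) ::
    (List.finRange n).map (fun j => .send j (.authPoint (verPoint s c j)))

end party

/-! ### Asynchronous executions with the broadcast functionality -/

/-- The moves of the adversary, who schedules everything and acts for the corrupt parties. -/
inductive Action (n : ℕ) (F : Type u) [Field F] where
  /-- deliver the `k`-th packet of the network -/
  | deliver (k : ℕ)
  /-- a corrupt party `src` sends a message -/
  | inject (src dst : Fin n) (m : Msg F)
  /-- a corrupt party gives an input to a broadcast instance of which it is the sender -/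
  | castInput (b : Cast n F)
  /-- party `i` obtains its output from the intermediary's broadcast instance -/
  | maskedOutput (i : Fin n)
  /-- party `i` obtains its output from the signer's broadcast instance -/
  | verdictOutput (i : Fin n)
  /-- party `i` is asked to take part in the revelation protocol -/
  | startReveal (i : Fin n)
  | idle

/-- What the adversary sees: its own moves; for every packet emitted by an honest party, the sender,
the recipient, the type of the message, and, if the recipient is corrupt, the message; and every
input of an honest party to the broadcast functionality. -/
inductive Event (n : ℕ) (F : Type u) [Field F] where
  | move (a : Action n F)
  | packet (src dst : Fin n) (kind : Kind) (content : Option (Msg F))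
  | cast (b : Cast n F)

/-- An adversary is computationally unbounded. It has a random tape, and its next move is an
arbitrary function of the tape and of what it has seen so far. -/
structure Adversary (n : ℕ) (F : Type u) [Field F] where
  Tape : Type
  next : Tape → List (Event n F) → Action n F

structure Packet (n : ℕ) (F : Type u) [Field F] where
  src : Fin n
  dst : Fin n
  msg : Msg F

/-- A global configuration.
* `loc`: the local states (only those of honest parties are used);
* `packets`: all the packets sent so far, in order; `delivered`: the positions of those delivered;
* `maskedCast`, `verdictCast`: the messages held by the two broadcast instances;
* `casts`: the inputs given by honest parties to the broadcast functionality;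
* `view`: what the adversary has seen, in order. -/
structure Config (n : ℕ) (F : Type u) [Field F] where
  loc : Fin n → PState n F
  packets : List (Packet n F)
  delivered : Finset ℕ
  maskedCast : Option (Masked n F)
  verdictCast : Option (Verdict F)
  casts : List (Cast n F)
  view : List (Event n F)

section execution

variable {n : ℕ} {F : Type u} [Field F]

/-- A broadcast instance takes the first input of its sender and ignores later ones. -/
def Config.addCast (b : Cast n F) (g : Config n F) : Config n F :=
  match b with
  | .masked m => { g with maskedCast := g.maskedCast.or (some m) }
  | .verdict v => { g with verdictCast := g.verdictCast.or (some v) }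

/-- The effect of what the honest party `i` emits; `Zs` is the set of corrupt parties. -/
def Config.emit (Zs : Finset (Fin n)) (i : Fin n) (g : Config n F) (o : Out n F) : Config n F :=
  match o with
  | .send dst m =>
      { g with
        packets := g.packets ++ [⟨i, dst, m⟩]
        view := g.view ++ [.packet i dst m.kind (if dst ∈ Zs then some m else none)] }
  | .cast b =>
      { g.addCast b with
        casts := g.casts ++ [b]
        view := g.view ++ [.cast b] }

/-- Party `i` handles a local event, whose direct effect at this party is `x`. -/
noncomputable def Config.handle (P : Session n) (Zs : Finset (Fin n)) (s : F)
    (c : Coins n P.t F) (i : Fin n) (x : PState n F × List (Out n F)) (g : Config n F) :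
    Config n F :=
  match react P s c i x with
  | (st, o) => o.foldl (Config.emit Zs i) { g with loc := Function.update g.loc i st }

/-- At the beginning an honest signer distributes the polynomials and the points. -/
noncomputable def start (P : Session n) (Zs : Finset (Fin n)) (s : F) (c : Coins n P.t F) :
    Config n F :=
  (if P.S ∈ Zs then [] else distribute P s c).foldl (Config.emit Zs P.S)
    ⟨fun _ => PState.initial n F, [], ∅, none, none, [], []⟩

/-- The effect of a move of the adversary; an illegal move has no effect. -/
noncomputable def Config.apply (P : Session n) (Zs : Finset (Fin n)) (s : F)
    (c : Coins n P.t F) (g : Config n F) : Action n F → Config n F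
  | .deliver k =>
      match g.packets[k]? with
      | some p =>
          if k ∈ g.delivered ∨ p.dst ∈ Zs then g
          else { g with delivered := insert k g.delivered }.handle P Zs s c p.dst
            (receive P p.dst p.src p.msg (g.loc p.dst))
      | none => g
  | .inject src dst m =>
      if src ∈ Zs then { g with packets := g.packets ++ [⟨src, dst, m⟩] } else g
  | .castInput (.masked m) => if P.I ∈ Zs then g.addCast (.masked m) else g
  | .castInput (.verdict v) => if P.S ∈ Zs then g.addCast (.verdict v) else g
  | .maskedOutput i =>
      if i ∈ Zs ∨ g.maskedCast = none then g
      else g.handle P Zs s c i ({ g.loc i with masked := g.maskedCast }, [])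
  | .verdictOutput i =>
      if i ∈ Zs ∨ g.verdictCast = none then g
      else g.handle P Zs s c i ({ g.loc i with verdict := g.verdictCast }, [])
  | .startReveal i =>
      if i ∈ Zs then g
      else g.handle P Zs s c i ({ g.loc i with revealing := True }, [])
  | .idle => g

/-- The execution with signer's input `s`, coins `c`, corrupt parties `Zs` and the adversary `A`
with random tape `r`: the configuration after `k` moves of the adversary. -/
noncomputable def run (P : Session n) (Zs : Finset (Fin n)) (A : Adversary n F) (r : A.Tape)
    (s : F) (c : Coins n P.t F) : ℕ → Config n F
  | 0 => start P Zs s c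
  | k + 1 =>
      let g := run P Zs A r s c k
      let a := A.next r g.view
      Config.apply P Zs s c { g with view := g.view ++ [.move a] } a

/-- Eventual delivery: every packet between honest parties is eventually delivered, and once a
broadcast instance holds a message, every honest party eventually obtains it. -/
structure EventualDelivery (Zs : Finset (Fin n)) (e : ℕ → Config n F) : Prop where
  packets : ∀ (k j : ℕ) (p : Packet n F), (e k).packets[j]? = some p → p.src ∉ Zs → p.dst ∉ Zs →
    ∃ k', j ∈ (e k').delivered
  masked : ∀ k, (e k).maskedCast.isSome → ∀ i ∉ Zs, ∃ k', ((e k').loc i).masked.isSome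
  verdict : ∀ k, (e k).verdictCast.isSome → ∀ i ∉ Zs, ∃ k', ((e k').loc i).verdict.isSome

/-- The revelation protocol is eventually invoked at every honest party. -/
def RevealInvoked (Zs : Finset (Fin n)) (e : ℕ → Config n F) : Prop :=
  ∀ i ∉ Zs, ∃ k, ((e k).loc i).revealing

/-- Every honest party eventually sets `authCompleted` to `1`. -/
def AllAuthComplete (Zs : Finset (Fin n)) (e : ℕ → Config n F) : Prop :=
  ∀ i ∉ Zs, ∃ k, ((e k).loc i).AuthCompleted

/-- The receiver (eventually) outputs `x`. -/
def Outputs (P : Session n) (e : ℕ → Config n F) (x : F) : Prop :=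
  ∃ k, ((e k).loc P.R).output = some x

/-- The intermediary (eventually) sets `ICSig(S, I, R, s)` to `σ`. -/
def SetsICSig (P : Session n) (e : ℕ → Config n F) (σ : ICSig F) : Prop :=
  ∃ k, ((e k).loc P.I).icSig P P.I = some σ

end execution

/-! ### Communication -/

section communication

variable {n : ℕ} {F : Type u} [Field F]

/-- Number of bits of a field element. -/
noncomputable def elemBits (F : Type u) : ℕ := Nat.clog 2 (Nat.card F)

/-- Number of bits of a polynomial: its coefficients, `t + 1` of them if the degree is at most
`t`. -/
noncomputable def polyBits (t : ℕ) (f : F[X]) : ℕ := (max t f.natDegree + 1) * elemBits F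

/-- Number of bits of a message: three bits for its type, and its content. -/
noncomputable def Msg.bits (t : ℕ) : Msg F → ℕ
  | .authPoly f g => 3 + (polyBits t f + polyBits t g)
  | .authPoint _ => 3 + 3 * elemBits F
  | .received => 3
  | .revealPoly f => 3 + polyBits t f
  | .revealPoint _ => 3 + 3 * elemBits F

/-- Number of bits of a broadcast message; the set `SV` is sent as `n` bits. -/
noncomputable def Cast.bits (t : ℕ) : Cast n F → ℕ
  | .masked m => elemBits F + polyBits t m.B + n
  | .verdict .ok => 1
  | .verdict (.nok _) => 1 + elemBits F

open Classical in
/-- Number of bits sent on the channels, during the authentication protocol, by honest parties. -/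
noncomputable def authBits (t : ℕ) (Zs : Finset (Fin n)) (g : Config n F) : ℕ :=
  ((g.packets.filter (fun p => p.src ∉ Zs ∧ p.msg.kind.IsAuth)).map (fun p => p.msg.bits t)).sum

open Classical in
/-- Number of bits sent on the channels, during the revelation protocol, by honest parties. -/
noncomputable def revealBits (t : ℕ) (Zs : Finset (Fin n)) (g : Config n F) : ℕ :=
  ((g.packets.filter (fun p => p.src ∉ Zs ∧ ¬ p.msg.kind.IsAuth)).map (fun p => p.msg.bits t)).sum

end communication

end AICP

/-! Every execution is a chain of small steps, each changing a few fields of a configuration. These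
steps drop guards that safety does not need and leave the view arbitrary. Two facts are proved by
induction over them. `Step.le`: nothing that has happened is undone. `Step.inv`: honest messages,
states and broadcasts have the contents that the protocol prescribes. Separately, `quiescent_run`
shows that no honest party ever has an enabled step pending. Liveness combines the three: eventual
delivery makes each needed condition true once, persistence makes all of them true at one common
time, quiescence forces the next action, and the invariants identify its content.

Correctness: honest $S$ and $I$ always produce a valid $B=dF+M$, so $S$ never complains. Honest
supporters hold points on $F$, and the other supporters lie in $Z^\star$, so $R$ accepts.

Privacy and unforgeability share a two-run simulation (`Coupled.run`). Two runs in which $S$ never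
complains, in which the corrupt parties get the same data and which agree on $d$ and on $dF+M$ give
the adversary the same view. For privacy, let $\Delta$ have degree at most $t$, $\Delta(0)=s'-s$ and
$\Delta(\alpha_j)=0$ for corrupt $P_j$. Replacing $(F,M)$ by $(F+\Delta,M-d\Delta)$ is a bijection
of the coins that turns input $s$ into $s'$ and preserves the view.

Unforgeability: a wrong output excludes a complaint. Fix all coins except the evaluation points of
the honest parties. In all bad runs with these fixed coins the view is the same, hence so are the
broadcast $(d,B,\mathcal{SV})$ and the polynomial $F'$ revealed by $I$. By $\mathbb Q^{(3)}$ some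
honest supporter $P_j$ was accepted. Since $S$ found $B$ consistent at $\alpha_j$, acceptance means
$F'(\alpha_j)=F(\alpha_j)$. As $F'(0)\ne s$, $\alpha_j$ is one of at most $t$ roots of a fixed
nonzero polynomial. A union bound over $j$ gives $nt/(|\mathbb F|-1)$.

Non-repudiation: with $S$ corrupt, only the coin $d$ is used, and it has no influence before $I$
announces. By then the polynomials of $I$ and the points of the honest supporters are fixed. A point
off $F$ escapes detection only if $d(F(\alpha_j)-v_j)=m_j-M(\alpha_j)$, which holds for at most one
$d$. This gives $n/(|\mathbb F|-1)$, and $t\ge1$ because $Z^\star$ contains $S$. If no point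
escapes, every honest supporter is accepted and $R$ outputs.

Communication: each honest sending action is charged to a flag or field that is set only once
(`CostInv`). -/

namespace AICP

universe u

variable {n : ℕ} {F : Type u} [Field F]

/-! ### Executions as sequences of elementary steps -/

/-- Party `i` replaces its local state by `x.1` and emits `x.2`. -/
def Config.commit (Zs : Finset (Fin n)) (i : Fin n) (x : PState n F × List (Out n F))
    (g : Config n F) : Config n F :=
  x.2.foldl (Config.emit Zs i) { g with loc := Function.update g.loc i x.1 }

/-- Party `i` carries out the rule `r`. -/
def Config.fire (Zs : Finset (Fin n)) (i : Fin n)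
    (r : PState n F → PState n F × List (Out n F)) (g : Config n F) : Config n F :=
  g.commit Zs i (r (g.loc i))

theorem Config.emit_setLoc (Zs : Finset (Fin n)) (i : Fin n) (g : Config n F) (o : Out n F)
    (l : Fin n → PState n F) :
    Config.emit Zs i { g with loc := l } o = { Config.emit Zs i g o with loc := l } := by
  rcases o with ⟨d, m⟩ | ⟨m | v⟩ <;> rfl

theorem Config.foldl_emit_setLoc (Zs : Finset (Fin n)) (i : Fin n) (o : List (Out n F))
    (g : Config n F) (l : Fin n → PState n F) :
    o.foldl (Config.emit Zs i) { g with loc := l } =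
      { o.foldl (Config.emit Zs i) g with loc := l } := by
  induction o generalizing g with
  | nil => rfl
  | cons a o ih => rw [List.foldl_cons, Config.emit_setLoc, ih, List.foldl_cons]

theorem Config.foldl_emit_loc (Zs : Finset (Fin n)) (i : Fin n) (o : List (Out n F))
    (g : Config n F) : (o.foldl (Config.emit Zs i) g).loc = g.loc := by
  have := congrArg Config.loc (Config.foldl_emit_setLoc Zs i o g g.loc)
  exact this

theorem Config.commit_loc (Zs : Finset (Fin n)) (i : Fin n) (x : PState n F × List (Out n F))
    (g : Config n F) : (g.commit Zs i x).loc = Function.update g.loc i x.1 :=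
  Config.foldl_emit_loc ..

/-- Emission neither reads nor writes local states, so emitting after every rule and emitting
everything after the last rule have the same effect. This lets a reaction be analysed one rule at a
time. -/
theorem Config.commit_andThen (Zs : Finset (Fin n)) (i : Fin n)
    (x : PState n F × List (Out n F)) (r : PState n F → PState n F × List (Out n F))
    (g : Config n F) :
    g.commit Zs i (andThen x r) = (g.commit Zs i x).fire Zs i r := by
  rw [Config.fire, Config.commit_loc, Function.update_self]
  simp only [andThen, Config.commit, List.foldl_append, Config.foldl_emit_setLoc,
    Function.update_idem]

theorem Config.handle_eq (P : Session n) (Zs : Finset (Fin n)) (s : F) (c : Coins n P.t F)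
    (i : Fin n) (x : PState n F × List (Out n F)) (g : Config n F) :
    g.handle P Zs s c i x =
      (((((g.commit Zs i x).fire Zs i (announce P c i)).fire Zs i (judge P s c i)).fire Zs i
        (sendPoly P i)).fire Zs i (sendPoint P i)).fire Zs i (decideOutput P i) := by
  simp only [← Config.commit_andThen]
  rfl

/-- The packet `p` has been taken into account in the local state `st` of its recipient. -/
def Processed (P : Session n) (p : Packet n F) (st : PState n F) : Prop :=
  match p.msg with
  | .authPoly f g =>
      p.dst = P.I → p.src = P.S → f.natDegree ≤ P.t → g.natDegree ≤ P.t → st.polys.isSome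
  | .authPoint _ => p.src = P.S → st.point.isSome
  | .received => p.dst = P.I → p.src ∈ st.confirmed
  | .revealPoly f => p.dst = P.R → p.src = P.I → f.natDegree ≤ P.t → st.revPoly.isSome
  | .revealPoint _ => p.dst = P.R → (st.revPoint p.src).isSome

/-- The elementary steps of an execution, with no constraint on the adversary's view. -/
inductive Step (P : Session n) (Zs : Finset (Fin n)) (s : F) (c : Coins n P.t F) :
    Config n F → Config n F → Prop
  | view (g v) : Step P Zs s c g { g with view := v }
  | inject (g) (p : Packet n F) (h : p.src ∈ Zs) :
      Step P Zs s c g { g with packets := g.packets ++ [p] }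
  | castMasked (g m) (h : P.I ∈ Zs) :
      Step P Zs s c g { g with maskedCast := g.maskedCast.or (some m) }
  | castVerdict (g v) (h : P.S ∈ Zs) :
      Step P Zs s c g { g with verdictCast := g.verdictCast.or (some v) }
  | ignore (g k) (p : Packet n F) (hp : g.packets[k]? = some p)
      (h : Processed P p (g.loc p.dst)) :
      Step P Zs s c g { g with delivered := insert k g.delivered }
  | recvPolys (g k f h) (hp : g.packets[k]? = some ⟨P.S, P.I, .authPoly f h⟩) (hI : P.I ∉ Zs)
      (hn : (g.loc P.I).polys = none) (hf : f.natDegree ≤ P.t) (hh : h.natDegree ≤ P.t) :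
      Step P Zs s c g { g with
        delivered := insert k g.delivered
        loc := Function.update g.loc P.I { g.loc P.I with polys := some (f, h) } }
  | recvPoint (g k j q v) (hp : g.packets[k]? = some ⟨P.S, j, .authPoint q⟩) (hj : j ∉ Zs)
      (hn : (g.loc j).point = none) :
      Step P Zs s c g { g with
        delivered := insert k g.delivered
        loc := Function.update g.loc j { g.loc j with point := some q }
        packets := g.packets ++ [⟨j, P.I, .received⟩]
        view := v }
  | recvConfirm (g k j) (hp : g.packets[k]? = some ⟨j, P.I, .received⟩) (hI : P.I ∉ Zs) :
      Step P Zs s c g { g with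
        delivered := insert k g.delivered
        loc := Function.update g.loc P.I
          { g.loc P.I with confirmed := insert j (g.loc P.I).confirmed } }
  | recvRevPoly (g k f) (hp : g.packets[k]? = some ⟨P.I, P.R, .revealPoly f⟩) (hR : P.R ∉ Zs)
      (hn : (g.loc P.R).revPoly = none) (hf : f.natDegree ≤ P.t) :
      Step P Zs s c g { g with
        delivered := insert k g.delivered
        loc := Function.update g.loc P.R { g.loc P.R with revPoly := some f } }
  | recvRevPoint (g k j q) (hp : g.packets[k]? = some ⟨j, P.R, .revealPoint q⟩) (hR : P.R ∉ Zs)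
      (hn : (g.loc P.R).revPoint j = none) :
      Step P Zs s c g { g with
        delivered := insert k g.delivered
        loc := Function.update g.loc P.R
          { g.loc P.R with revPoint := Function.update (g.loc P.R).revPoint j (some q) } }
  | maskedOutput (g i) (hi : i ∉ Zs) (h : g.maskedCast.isSome) :
      Step P Zs s c g { g with
        loc := Function.update g.loc i { g.loc i with masked := g.maskedCast } }
  | verdictOutput (g i) (hi : i ∉ Zs) (h : g.verdictCast.isSome) :
      Step P Zs s c g { g with
        loc := Function.update g.loc i { g.loc i with verdict := g.verdictCast } }
  | startReveal (g i) (hi : i ∉ Zs) :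
      Step P Zs s c g { g with
        loc := Function.update g.loc i { g.loc i with revealing := True } }
  | announce (g f h v) (hI : P.I ∉ Zs) (hp : (g.loc P.I).polys = some (f, h))
      (ha : ¬ (g.loc P.I).announced) (hc : Finset.univ \ (g.loc P.I).confirmed ∈ P.Z) :
      Step P Zs s c g { g with
        loc := Function.update g.loc P.I { g.loc P.I with announced := True }
        maskedCast := g.maskedCast.or
          (some ⟨combiner c, C (combiner c) * f + h, (g.loc P.I).confirmed⟩)
        casts := g.casts ++
          [.masked ⟨combiner c, C (combiner c) * f + h, (g.loc P.I).confirmed⟩]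
        view := v }
  | judge (g b x v) (hS : P.S ∉ Zs) (hb : (g.loc P.S).masked = some b)
      (hj : ¬ (g.loc P.S).judged)
      (hx : (x = .ok ∧ Valid P s c b) ∨ (x = .nok s ∧ ¬ Valid P s c b)) :
      Step P Zs s c g { g with
        loc := Function.update g.loc P.S { g.loc P.S with judged := True }
        verdictCast := g.verdictCast.or (some x)
        casts := g.casts ++ [.verdict x]
        view := v }
  | sendPoly (g f h v) (hI : P.I ∉ Zs) (hp : (g.loc P.I).polys = some (f, h))
      (hs : ¬ (g.loc P.I).polySent) :
      Step P Zs s c g { g with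
        loc := Function.update g.loc P.I { g.loc P.I with polySent := True }
        packets := g.packets ++ [⟨P.I, P.R, .revealPoly f⟩]
        view := v }
  | sendPoint (g i q v) (hi : i ∉ Zs) (hp : (g.loc i).point = some q)
      (hs : ¬ (g.loc i).pointSent) :
      Step P Zs s c g { g with
        loc := Function.update g.loc i { g.loc i with pointSent := True }
        packets := g.packets ++ [⟨i, P.R, .revealPoint q⟩]
        view := v }
  | outputSecret (g b x) (hR : P.R ∉ Zs) (ho : (g.loc P.R).output = none)
      (hb : (g.loc P.R).masked = some b) (hv : (g.loc P.R).verdict = some (.nok x)) :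
      Step P Zs s c g { g with
        loc := Function.update g.loc P.R { g.loc P.R with output := some x } }
  | outputPoly (g b f) (hR : P.R ∉ Zs) (ho : (g.loc P.R).output = none)
      (hb : (g.loc P.R).masked = some b) (hv : (g.loc P.R).verdict = some .ok)
      (hf : (g.loc P.R).revPoly = some f) (he : EnoughAccepted P b f (g.loc P.R).revPoint) :
      Step P Zs s c g { g with
        loc := Function.update g.loc P.R { g.loc P.R with output := some (f.eval 0) } }

/-- Any number of elementary steps. -/
abbrev Steps (P : Session n) (Zs : Finset (Fin n)) (s : F) (c : Coins n P.t F) :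
    Config n F → Config n F → Prop :=
  Relation.ReflTransGen (Step P Zs s c)

section steps

variable {P : Session n} {Zs : Finset (Fin n)} {s : F} {c : Coins n P.t F} {g : Config n F}

theorem Config.commit_self (i : Fin n) : g.commit Zs i (g.loc i, []) = g := by
  simp [Config.commit]

/-! ### Rules and adversarial moves decompose into elementary steps -/

theorem steps_announce {i : Fin n} (hi : i ∉ Zs) :
    Steps P Zs s c g (g.fire Zs i (announce P c i)) := by
  rw [Config.fire, AICP.announce]
  split
  · rename_i f h hp
    split_ifs with hc
    · obtain ⟨rfl, ha, hc⟩ := hc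
      exact .single (.announce g f h _ hi hp ha hc)
    · rw [Config.commit_self]
  · rw [Config.commit_self]

theorem steps_judge {i : Fin n} (hi : i ∉ Zs) :
    Steps P Zs s c g (g.fire Zs i (judge P s c i)) := by
  rw [Config.fire, AICP.judge]
  split
  · rename_i b hb
    split_ifs with hc hV
    · obtain ⟨rfl, ha⟩ := hc
      exact .single (.judge g b .ok _ hi hb ha (.inl ⟨rfl, hV⟩))
    · obtain ⟨rfl, ha⟩ := hc
      exact .single (.judge g b (.nok s) _ hi hb ha (.inr ⟨rfl, hV⟩))
    · rw [Config.commit_self]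
  · rw [Config.commit_self]

theorem PState.icSig_eq_poly {i : Fin n} {st : PState n F} {f : F[X]} :
    st.icSig P i = some (.poly f) ↔
      i = P.I ∧ st.masked.isSome ∧ st.verdict = some .ok ∧ ∃ h, st.polys = some (f, h) := by
  unfold PState.icSig
  split
  · rename_i h1 h2
    simp [h2]
  · rename_i h1 h2
    by_cases hi : i = P.I
    · simp [h1, h2, hi]
    · simp [hi]
  · rename_i h1 h2
    simp only [reduceCtorEq, false_iff, not_and, not_exists]
    intro _ hm hv
    obtain ⟨b, hb⟩ := Option.isSome_iff_exists.1 hm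
    exact absurd hv (h2 b hb)

theorem steps_sendPoly {i : Fin n} (hi : i ∉ Zs) :
    Steps P Zs s c g (g.fire Zs i (sendPoly P i)) := by
  rw [Config.fire, AICP.sendPoly]
  split
  · rename_i f hp
    split_ifs with hc
    · obtain ⟨rfl, -, hs⟩ := hc
      obtain ⟨-, -, -, h, hp⟩ := PState.icSig_eq_poly.1 hp
      exact .single (.sendPoly g f h _ hi hp hs)
    · rw [Config.commit_self]
  · rw [Config.commit_self]

theorem steps_sendPoint {i : Fin n} (hi : i ∉ Zs) :
    Steps P Zs s c g (g.fire Zs i (sendPoint P i)) := by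
  rw [Config.fire, AICP.sendPoint]
  split
  · rename_i b q hb hv hp
    split_ifs with hc
    · exact .single (.sendPoint g i q _ hi hp hc.2.2)
    · rw [Config.commit_self]
  · rw [Config.commit_self]

theorem steps_decideOutput {i : Fin n} (hi : i ∉ Zs) :
    Steps P Zs s c g (g.fire Zs i (decideOutput P i)) := by
  rw [Config.fire, AICP.decideOutput]
  split_ifs with hc
  · obtain ⟨rfl, -, ho⟩ := hc
    split
    · rename_i b x hb hv
      exact .single (.outputSecret g b x hi ho hb hv)
    · rename_i b f hb hv hf
      split_ifs with he
      · exact .single (.outputPoly g b f hi ho hb hv hf he)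
      · rw [Config.commit_self]
    · rw [Config.commit_self]
  · rw [Config.commit_self]

/-- The event itself is a single step and each of the five rules adds at most one more. The separate
`g₀` allows the event also to mark a packet as delivered. -/
theorem steps_handle {i : Fin n} (hi : i ∉ Zs) {x : PState n F × List (Out n F)}
    {g₀ : Config n F} (h : Step P Zs s c g₀ (g.commit Zs i x)) :
    Steps P Zs s c g₀ (g.handle P Zs s c i x) := by
  rw [Config.handle_eq]
  exact (((((Relation.ReflTransGen.single h).trans (steps_announce hi)).trans
    (steps_judge hi)).trans (steps_sendPoly hi)).trans (steps_sendPoint hi)).trans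
    (steps_decideOutput hi)

/-- A discarded message is an `ignore` step: it is discarded because a guard of `Processed` fails or
because the field that it would fill is already filled, and either way `Processed` holds. -/
theorem step_receive {k : ℕ} {p : Packet n F} (hp : g.packets[k]? = some p) (hd : p.dst ∉ Zs) :
    Step P Zs s c g (({ g with delivered := insert k g.delivered } : Config n F).commit Zs p.dst
      (receive P p.dst p.src p.msg (g.loc p.dst))) := by
  have ign (h : Processed P p (g.loc p.dst)) : Step P Zs s c g
      (({ g with delivered := insert k g.delivered } : Config n F).commit Zs p.dst
        (g.loc p.dst, [])) := by
    have := Step.ignore (P := P) (Zs := Zs) (s := s) (c := c) g k p hp h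
    simpa [Config.commit] using this
  rcases p with ⟨src, dst, f | q | _ | f | q⟩ <;> simp only [receive] at hd ⊢
  · split_ifs with hc
    · obtain ⟨rfl, rfl, hn, hf, hh⟩ := hc
      exact .recvPolys g k _ _ hp hd hn hf hh
    · refine ign ?_
      simp only [Processed]
      intro h1 h2 h3 h4
      rw [Option.isSome_iff_ne_none]
      exact fun h => hc ⟨h1, h2, h, h3, h4⟩
  · split_ifs with hc
    · obtain ⟨rfl, hn⟩ := hc
      exact .recvPoint g k _ _ _ hp hd hn
    · refine ign ?_
      simp only [Processed]
      intro h1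
      rw [Option.isSome_iff_ne_none]
      exact fun h => hc ⟨h1, h⟩
  · split_ifs with hc
    · obtain rfl := hc
      exact .recvConfirm g k _ hp hd
    · exact ign fun h => absurd h hc
  · split_ifs with hc
    · obtain ⟨rfl, rfl, hn, hf⟩ := hc
      exact .recvRevPoly g k _ hp hd hn hf
    · refine ign ?_
      simp only [Processed]
      intro h1 h2 h3
      rw [Option.isSome_iff_ne_none]
      exact fun h => hc ⟨h1, h2, h, h3⟩
  · split_ifs with hc
    · obtain ⟨rfl, hn⟩ := hc
      exact .recvRevPoint g k _ _ hp hd hn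
    · refine ign ?_
      simp only [Processed]
      intro h1
      rw [Option.isSome_iff_ne_none]
      exact fun h => hc ⟨h1, h⟩

theorem steps_apply (a : Action n F) : Steps P Zs s c g (g.apply P Zs s c a) := by
  rcases a with k | ⟨src, dst, m⟩ | ⟨m | v⟩ | i | i | i | _ <;> simp only [Config.apply]
  · split
    · rename_i p hp
      split_ifs with hc
      · rfl
      · exact steps_handle (fun h => hc (.inr h)) (step_receive hp fun h => hc (.inr h))
    · rfl
  · split_ifs with hc
    · exact .single (.inject g ⟨src, dst, m⟩ hc)
    · rfl
  · split_ifs with hc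
    · exact .single (.castMasked g m hc)
    · rfl
  · split_ifs with hc
    · exact .single (.castVerdict g v hc)
    · rfl
  · split_ifs with hc
    · rfl
    · rw [not_or] at hc
      exact steps_handle hc.1 (.maskedOutput g i hc.1 (Option.isSome_iff_ne_none.2 hc.2))
  · split_ifs with hc
    · rfl
    · rw [not_or] at hc
      exact steps_handle hc.1 (.verdictOutput g i hc.1 (Option.isSome_iff_ne_none.2 hc.2))
  · split_ifs with hc
    · rfl
    · exact steps_handle hc (.startReveal g i hc)
  · rfl

variable (P Zs s c) in
theorem steps_run_succ (A : Adversary n F) (r : A.Tape) (k : ℕ) :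
    Steps P Zs s c (run P Zs A r s c k) (run P Zs A r s c (k + 1)) :=
  (Relation.ReflTransGen.single (.view _ _)).trans (steps_apply _)

variable (P Zs s c) in
theorem steps_run (A : Adversary n F) (r : A.Tape) {k l : ℕ} (h : k ≤ l) :
    Steps P Zs s c (run P Zs A r s c k) (run P Zs A r s c l) := by
  induction l, h using Nat.le_induction with
  | base => rfl
  | succ m _ ih => exact ih.trans (steps_run_succ P Zs s c A r m)

/-- The packets that an honest signer sends at the beginning. -/
noncomputable def initialPackets (P : Session n) (s : F) (c : Coins n P.t F) :
    List (Packet n F) :=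
  ⟨P.S, P.I, .authPoly (signPoly s c) (maskPoly c)⟩ ::
    (List.finRange n).map fun j => ⟨P.S, j, .authPoint (verPoint s c j)⟩

theorem foldl_emit_send {α : Type*} (i : Fin n) (d : α → Fin n) (m : α → Msg F) (l : List α) :
    ∃ v, (l.map fun a => Out.send (d a) (m a)).foldl (Config.emit Zs i) g =
      { g with packets := g.packets ++ l.map fun a => ⟨i, d a, m a⟩, view := v } := by
  induction l generalizing g with
  | nil => exact ⟨g.view, by simp⟩
  | cons a l ih =>
    obtain ⟨v, hv⟩ := ih (g := Config.emit Zs i g (.send (d a) (m a)))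
    exact ⟨v, by rw [List.map_cons, List.foldl_cons, hv]; simp [Config.emit]⟩

variable (P Zs s c) in
theorem start_eq : ∃ v, start P Zs s c =
    ⟨fun _ => PState.initial n F, if P.S ∈ Zs then [] else initialPackets P s c,
      ∅, none, none, [], v⟩ := by
  unfold start distribute
  split_ifs
  · exact ⟨_, rfl⟩
  · rw [List.foldl_cons]
    obtain ⟨v, hv⟩ := foldl_emit_send (Zs := Zs) (g := Config.emit Zs P.S
      ⟨fun _ => PState.initial n F, [], ∅, none, none, [], []⟩
      (.send P.I (.authPoly (signPoly s c) (maskPoly c)))) P.S id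
      (fun j => .authPoint (verPoint s c j)) (List.finRange n)
    exact ⟨v, hv⟩

end steps

/-! ### Invariants of executions -/

/-- What happens in an execution is never undone. -/
structure Config.Le (g g' : Config n F) : Prop where
  packets : ∀ (k : ℕ) (p : Packet n F), g.packets[k]? = some p → g'.packets[k]? = some p
  delivered : g.delivered ⊆ g'.delivered
  polys : ∀ i q, (g.loc i).polys = some q → (g'.loc i).polys = some q
  point : ∀ i q, (g.loc i).point = some q → (g'.loc i).point = some q
  confirmed : ∀ i, (g.loc i).confirmed ⊆ (g'.loc i).confirmed
  masked : ∀ i b, (g.loc i).masked = some b → (g'.loc i).masked = some b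
  verdict : ∀ i v, (g.loc i).verdict = some v → (g'.loc i).verdict = some v
  revealing : ∀ i, (g.loc i).revealing → (g'.loc i).revealing
  revPoly : ∀ i f, (g.loc i).revPoly = some f → (g'.loc i).revPoly = some f
  revPoint : ∀ i j q, (g.loc i).revPoint j = some q → (g'.loc i).revPoint j = some q
  output : ∀ i x, (g.loc i).output = some x → (g'.loc i).output = some x
  maskedCast : ∀ b, g.maskedCast = some b → g'.maskedCast = some b
  verdictCast : ∀ v, g.verdictCast = some v → g'.verdictCast = some v
  casts : ∀ b ∈ g.casts, b ∈ g'.casts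

/-- The invariants of an execution. -/
structure Inv (P : Session n) (Zs : Finset (Fin n)) (s : F) (c : Coins n P.t F)
    (g : Config n F) : Prop where
  masked : ∀ i b, (g.loc i).masked = some b → g.maskedCast = some b
  verdict : ∀ i v, (g.loc i).verdict = some v → g.verdictCast = some v
  authPoly : ∀ (k : ℕ) p f h, g.packets[k]? = some p → p.src ∉ Zs → p.msg = .authPoly f h →
    p.src = P.S ∧ p.dst = P.I ∧ f = signPoly s c ∧ h = maskPoly c
  authPoint : ∀ (k : ℕ) p q, g.packets[k]? = some p → p.src ∉ Zs → p.msg = .authPoint q →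
    p.src = P.S ∧ q = verPoint s c p.dst
  received : ∀ (k : ℕ) p, g.packets[k]? = some p → p.src ∉ Zs → p.msg = .received →
    p.dst = P.I ∧ (g.loc p.src).point.isSome
  revealPoly : ∀ (k : ℕ) p f, g.packets[k]? = some p → p.src ∉ Zs → p.msg = .revealPoly f →
    p.src = P.I ∧ p.dst = P.R ∧ ∃ h, (g.loc P.I).polys = some (f, h)
  revealPoint : ∀ (k : ℕ) p q, g.packets[k]? = some p → p.src ∉ Zs → p.msg = .revealPoint q →
    p.dst = P.R ∧ (g.loc p.src).point = some q
  polys_natDegree : ∀ i f h, (g.loc i).polys = some (f, h) →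
    f.natDegree ≤ P.t ∧ h.natDegree ≤ P.t
  polys : P.S ∉ Zs → ∀ f h, (g.loc P.I).polys = some (f, h) → f = signPoly s c ∧ h = maskPoly c
  point : P.S ∉ Zs → ∀ i q, (g.loc i).point = some q → q = verPoint s c i
  confirmed : ∀ j ∈ (g.loc P.I).confirmed, j ∉ Zs → (g.loc j).point.isSome
  revPoly_natDegree : ∀ i f, (g.loc i).revPoly = some f → f.natDegree ≤ P.t
  revPoly : P.I ∉ Zs → ∀ f, (g.loc P.R).revPoly = some f → ∃ h, (g.loc P.I).polys = some (f, h)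
  revPoint : ∀ j q, (g.loc P.R).revPoint j = some q → j ∉ Zs → (g.loc j).point = some q
  maskedCast : P.I ∉ Zs → ∀ b, g.maskedCast = some b →
    ∃ f h, (g.loc P.I).polys = some (f, h) ∧ b.d = combiner c ∧
      b.B = C (combiner c) * f + h ∧ Finset.univ \ b.SV ∈ P.Z ∧
      ∀ j ∈ b.SV, j ∉ Zs → (g.loc j).point.isSome
  verdictCast : P.S ∉ Zs → ∀ v, g.verdictCast = some v → .verdict v ∈ g.casts
  verdict_mem_casts : ∀ v, .verdict v ∈ g.casts → ∃ b, g.maskedCast = some b ∧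
    ((v = .ok ∧ Valid P s c b) ∨ (v = .nok s ∧ ¬ Valid P s c b))
  output : ∀ x, (g.loc P.R).output = some x → ∃ b, g.maskedCast = some b ∧
    (g.verdictCast = some (.nok x) ∨
      (g.verdictCast = some .ok ∧ ∃ f, (g.loc P.R).revPoly = some f ∧ x = f.eval 0 ∧
        EnoughAccepted P b f (g.loc P.R).revPoint))
  announced : (g.loc P.I).announced → g.maskedCast.isSome
  judged : (g.loc P.S).judged → g.verdictCast.isSome
  polySent : (g.loc P.I).polySent →
    ∃ (k : ℕ) (f : F[X]), g.packets[k]? = some ⟨P.I, P.R, .revealPoly f⟩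
  pointSent : ∀ i, (g.loc i).pointSent →
    ∃ (k : ℕ) (q : Point F), g.packets[k]? = some ⟨i, P.R, .revealPoint q⟩
  confirming : ∀ i, (g.loc i).point.isSome →
    ∃ k : ℕ, g.packets[k]? = some ⟨i, P.I, .received⟩
  processed : ∀ k ∈ g.delivered, ∃ p, g.packets[k]? = some p ∧ Processed P p (g.loc p.dst)

section invariants

variable {P : Session n} {Zs : Finset (Fin n)} {s : F} {c : Coins n P.t F} {g g' : Config n F}

theorem Config.Le.refl (g : Config n F) : g.Le g := by
  constructor <;> simp

theorem Config.Le.trans {g'' : Config n F} (h : g.Le g') (h' : g'.Le g'') : g.Le g'' := by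
  constructor
  case delivered => exact h.delivered.trans h'.delivered
  case confirmed => exact fun i => (h.confirmed i).trans (h'.confirmed i)
  all_goals cases h; cases h'; grind

theorem getElem?_append_singleton {α : Type*} {l : List α} {a : α} {k : ℕ} {b : α} :
    (l ++ [a])[k]? = some b ↔ l[k]? = some b ∨ (k = l.length ∧ a = b) := by
  grind

-- Only broadcast outputs can overwrite a filled field. The invariants `masked` and `verdict` say
-- that such a field already equals the message held by the broadcast instance, which never changes
-- once set.
set_option maxHeartbeats 1000000 in
theorem Step.le (hg : Inv P Zs s c g) (h : Step P Zs s c g g') : g.Le g' := by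
  have hm := hg.masked
  have hv := hg.verdict
  clear hg
  cases h <;> constructor
  case recvRevPoint.revPoint k j' q' hp hR hn =>
    intro i j q h
    by_cases hi : i = P.R
    · by_cases hj : j = j' <;> simp_all
    · simpa [Function.update_apply, hi] using h
  all_goals grind [Function.update_apply]

theorem EnoughAccepted.mono {b : Masked n F} {f : F[X]} {q q' : Fin n → Option (Point F)}
    (h : EnoughAccepted P b f q) (hq : ∀ j p, q j = some p → q' j = some p) :
    EnoughAccepted P b f q' := by
  obtain ⟨A, hA, hZ, h⟩ := h
  refine ⟨A, hA, hZ, fun j hj => ?_⟩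
  obtain ⟨p, hp, ha⟩ := h j hj
  exact ⟨p, hq j p hp, ha⟩

theorem Processed.mono {p : Packet n F} (h : Processed P p (g.loc p.dst)) (hg : g.Le g') :
    Processed P p (g'.loc p.dst) := by
  rcases p with ⟨src, dst, f | q | _ | f | q⟩ <;> simp only [Processed] at h ⊢ <;>
    cases hg <;> grind [Option.isSome_iff_exists]

-- Each invariant follows from itself, the few invariants on the data that it copies, and
-- persistence. Unneeded facts are cleared before each case analysis.
set_option maxHeartbeats 4000000 in
theorem Step.inv (hg : Inv P Zs s c g) (h : Step P Zs s c g g') : Inv P Zs s c g' := by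
  have hle := h.le hg
  constructor
  case masked => have := hg.masked; clear hg hle; cases h <;> grind [Function.update_apply]
  case verdict => have := hg.verdict; clear hg hle; cases h <;> grind [Function.update_apply]
  case authPoly =>
    have := hg.authPoly; clear hg hle
    cases h <;> grind [getElem?_append_singleton]
  case authPoint =>
    have := hg.authPoint; clear hg hle
    cases h <;> grind [getElem?_append_singleton]
  case received =>
    have := hg.received; clear hg hle
    cases h <;> grind [getElem?_append_singleton, Function.update_apply]
  case revealPoly =>
    have := hg.revealPoly; clear hg hle
    cases h <;> grind [getElem?_append_singleton, Function.update_apply]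
  case revealPoint =>
    have := hg.revealPoint; clear hg hle
    cases h <;> grind [getElem?_append_singleton, Function.update_apply]
  case polys_natDegree =>
    have := hg.polys_natDegree; clear hg hle
    cases h <;> grind [Function.update_apply]
  case polys =>
    have := hg.polys; have := hg.authPoly; clear hg hle
    cases h <;> grind [Function.update_apply]
  case point =>
    have := hg.point; have := hg.authPoint; clear hg hle
    cases h <;> grind [Function.update_apply]
  case confirmed =>
    have := hg.confirmed; have := hg.received; clear hg hle
    cases h <;> grind [Function.update_apply]
  case revPoly_natDegree =>
    have := hg.revPoly_natDegree; clear hg hle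
    cases h <;> grind [Function.update_apply]
  case revPoly =>
    have := hg.revPoly; have := hg.revealPoly; clear hg hle
    cases h <;> grind [Function.update_apply]
  case revPoint =>
    have := hg.revPoint; have := hg.revealPoint; have := hle.point; clear hg hle
    cases h
    case recvRevPoint k j' q' hp hR hn =>
      intro j q
      by_cases hj : j = j' <;> simp [Function.update_self, hj] <;> grind
    all_goals grind [Function.update_apply]
  case maskedCast =>
    intro hI b hb
    have old (hb : g.maskedCast = some b) := hg.maskedCast hI b hb
    have mono (f h : F[X]) (hp : (g.loc P.I).polys = some (f, h))
        (hS : ∀ j ∈ b.SV, j ∉ Zs → (g.loc j).point.isSome) :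
        (g'.loc P.I).polys = some (f, h) ∧ ∀ j ∈ b.SV, j ∉ Zs → (g'.loc j).point.isSome := by
      refine ⟨hle.polys _ _ hp, fun j hj hjZ => ?_⟩
      obtain ⟨q, hq⟩ := Option.isSome_iff_exists.1 (hS j hj hjZ)
      simp [hle.point _ _ hq]
    have hc := hg.confirmed
    -- Either `b` was already held and its description persists, or this very step put it there.
    -- With an honest intermediary the latter can only be the announcement.
    by_cases hb' : g.maskedCast = some b
    · grind
    · clear old hg hle
      cases h
      case announce f h v hI hp ha hc' =>
        have : b = ⟨combiner c, C (combiner c) * f + h, (g.loc P.I).confirmed⟩ := by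
          rcases hM : g.maskedCast with _ | b₀
          · simpa [hM, eq_comm] using hb
          · exact absurd (by simpa [hM] using hb) hb'
        subst this
        exact ⟨f, h, (mono f h hp hc).1, rfl, rfl, hc', (mono f h hp hc).2⟩
      all_goals grind
  case verdictCast =>
    intro hS v hv
    have old := hg.verdictCast hS v; have := hle.casts; clear hg hle
    by_cases hv' : g.verdictCast = some v
    · exact this _ (old hv')
    · cases h
      case judge b x w hS hb hj hx =>
        rcases hM : g.verdictCast with _ | v₀
        · simp_all
        · exact absurd (by simpa [hM] using hv) hv'
      all_goals grind
  case verdict_mem_casts =>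
    have := hg.verdict_mem_casts; have := hg.masked; have := hle.maskedCast; clear hg hle
    cases h <;> grind
  case output =>
    intro x
    have := hg.output x; have := hg.masked; have := hg.verdict
    have := hle.maskedCast; have := hle.verdictCast; have := hle.revPoly P.R
    have := fun b f h => EnoughAccepted.mono (P := P) (b := b) (f := f) h (hle.revPoint P.R)
    clear hg hle
    cases h <;> grind [Function.update_apply]
  case announced => have := hg.announced; clear hg hle; cases h <;> grind [Function.update_apply]
  case judged => have := hg.judged; clear hg hle; cases h <;> grind [Function.update_apply]
  case polySent =>
    have old := hg.polySent; have := hle.packets; clear hg hle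
    cases h
    case sendPoly f h v hI hp hs => exact fun _ => ⟨g.packets.length, f, by simp⟩
    all_goals
      intro hs
      obtain ⟨k, f, hk⟩ := old (by grind [Function.update_apply])
      exact ⟨k, f, this _ _ hk⟩
  case pointSent =>
    intro i
    have old := hg.pointSent i; have := hle.packets; clear hg hle
    cases h
    case sendPoint j q v hj hp hs =>
      by_cases hi : i = j
      · exact fun _ => ⟨g.packets.length, q, by simp [hi]⟩
      · intro hs
        obtain ⟨k, f, hk⟩ := old (by simpa [hi] using hs)
        exact ⟨k, f, this _ _ hk⟩
    all_goals
      intro hs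
      obtain ⟨k, f, hk⟩ := old (by grind [Function.update_apply])
      exact ⟨k, f, this _ _ hk⟩
  case confirming =>
    intro i
    have old := hg.confirming i; have := hle.packets; clear hg hle
    cases h
    case recvPoint k j q v hp hj hn =>
      by_cases hi : i = j
      · exact fun _ => ⟨g.packets.length, by simp [hi]⟩
      · intro hs
        obtain ⟨k, hk⟩ := old (by simpa [hi] using hs)
        exact ⟨k, this _ _ hk⟩
    all_goals
      intro hs
      obtain ⟨k, hk⟩ := old (by grind [Function.update_apply])
      exact ⟨k, this _ _ hk⟩
  case processed =>
    intro k hk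
    by_cases hk' : k ∈ g.delivered
    · obtain ⟨p, hp, hpr⟩ := hg.processed k hk'
      exact ⟨p, hle.packets k p hp, hpr.mono hle⟩
    · have hpk := hle.packets k
      clear hg hle
      cases h <;> simp_all [Processed]

variable (P Zs s c) in
theorem inv_start : Inv P Zs s c (start P Zs s c) := by
  obtain ⟨v, hv⟩ := start_eq P Zs s c
  rw [hv]
  have mem (k : ℕ) (p : Packet n F)
      (hp : (if P.S ∈ Zs then [] else initialPackets P s c)[k]? = some p) :
      p = ⟨P.S, P.I, .authPoly (signPoly s c) (maskPoly c)⟩ ∨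
        ∃ j, p = ⟨P.S, j, .authPoint (verPoint s c j)⟩ := by
    split_ifs at hp
    · simp at hp
    · have := List.mem_of_getElem? hp
      simpa [initialPackets, eq_comm] using this
  constructor
  case authPoly | authPoint | received | revealPoly | revealPoint =>
    intro k p
    intros
    rcases mem k p (by assumption) with rfl | ⟨j, rfl⟩ <;> simp_all
  all_goals simp [PState.initial]

theorem Steps.inv_le (hg : Inv P Zs s c g) (h : Steps P Zs s c g g') :
    Inv P Zs s c g' ∧ g.Le g' := by
  induction h with
  | refl => exact ⟨hg, .refl g⟩
  | tail _ h ih => exact ⟨h.inv ih.1, ih.2.trans (h.le ih.1)⟩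

variable (P Zs s c) in
theorem inv_run (A : Adversary n F) (r : A.Tape) (k : ℕ) :
    Inv P Zs s c (run P Zs A r s c k) :=
  (Steps.inv_le (inv_start P Zs s c) (steps_run P Zs s c A r (Nat.zero_le k))).1

variable (P Zs s c) in
theorem run_le (A : Adversary n F) (r : A.Tape) {k l : ℕ} (h : k ≤ l) :
    (run P Zs A r s c k).Le (run P Zs A r s c l) :=
  (Steps.inv_le (inv_run P Zs s c A r k) (steps_run P Zs s c A r h)).2

/-! ### Quiescence: all enabled steps of honest parties have been carried out -/

theorem announce_fst (i : Fin n) (st : PState n F) : (announce P c i st).1 =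
    { st with announced := st.announced ∨
        (i = P.I ∧ st.polys.isSome ∧ Finset.univ \ st.confirmed ∈ P.Z) } := by
  rcases st with ⟨_ | ⟨f, h⟩, _⟩ <;> simp only [announce]
  · simp
  · split_ifs <;> grind

theorem judge_fst (i : Fin n) (st : PState n F) : (judge P s c i st).1 =
    { st with judged := st.judged ∨ (i = P.S ∧ st.masked.isSome) } := by
  unfold judge
  split
  · rename_i b hb
    cases st
    split_ifs <;> simp only [PState.mk.injEq, eq_iff_iff, true_and, and_true] <;> simp_all
  · rename_i h
    cases st
    simp_all

theorem sendPoly_fst (i : Fin n) (st : PState n F) : (sendPoly P i st).1 =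
    { st with polySent := st.polySent ∨
        (i = P.I ∧ st.revealing ∧ ∃ f, st.icSig P i = some (.poly f)) } := by
  unfold sendPoly
  split
  · rename_i f hf
    cases st
    split_ifs <;> simp only [PState.mk.injEq, eq_iff_iff, true_and, and_true] <;> simp_all
  · rename_i h
    have : ¬ ∃ f, st.icSig P i = some (.poly f) := fun ⟨f, hf⟩ => h f hf
    simp [this]

theorem sendPoint_fst (i : Fin n) (st : PState n F) : (sendPoint P i st).1 =
    { st with pointSent := st.pointSent ∨
        (st.revealing ∧ st.point.isSome ∧ st.verdict = some .ok ∧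
          ∃ b, st.masked = some b ∧ i ∈ b.SV) } := by
  unfold sendPoint
  split
  · rename_i b q hb hv hq
    cases st
    split_ifs <;> simp only [PState.mk.injEq, eq_iff_iff, true_and] <;> simp_all
  · rename_i h
    have : ¬ (st.point.isSome ∧ st.verdict = some .ok ∧ ∃ b, st.masked = some b ∧ i ∈ b.SV) := by
      rintro ⟨hq, hv, b, hb, -⟩
      obtain ⟨q, hq⟩ := Option.isSome_iff_exists.1 hq
      exact h b q hb hv hq
    simp [this]

/-- No step of party `i` is enabled. -/
structure Quiescent (P : Session n) (i : Fin n) (st : PState n F) : Prop where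
  announced : i = P.I → st.polys.isSome → Finset.univ \ st.confirmed ∈ P.Z → st.announced
  judged : i = P.S → st.masked.isSome → st.judged
  polySent : i = P.I → st.revealing → st.masked.isSome → st.verdict = some .ok →
    st.polys.isSome → st.polySent
  pointSent : st.revealing → st.point.isSome → st.verdict = some .ok →
    ∀ b, st.masked = some b → i ∈ b.SV → st.pointSent
  outputSecret : i = P.R → st.revealing → st.masked.isSome → ∀ x, st.verdict = some (.nok x) →
    st.output.isSome
  outputPoly : i = P.R → st.revealing → ∀ b, st.masked = some b → st.verdict = some .ok →
    ∀ f, st.revPoly = some f → EnoughAccepted P b f st.revPoint → st.output.isSome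

/-- Each of the first four rules changes only its own flag and no other rule reads that flag, so all
four flags can be computed from the initial state. The right-hand side mentions neither `s` nor `c`;
non-repudiation relies on this. -/
theorem react_fst_eq (i : Fin n) (x : PState n F × List (Out n F)) :
    (react P s c i x).1 = (decideOutput P i
      { x.1 with
        announced := x.1.announced ∨
          (i = P.I ∧ x.1.polys.isSome ∧ Finset.univ \ x.1.confirmed ∈ P.Z)
        judged := x.1.judged ∨ (i = P.S ∧ x.1.masked.isSome)
        polySent := x.1.polySent ∨
          (i = P.I ∧ x.1.revealing ∧ ∃ f, x.1.icSig P i = some (.poly f))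
        pointSent := x.1.pointSent ∨
          (x.1.revealing ∧ x.1.point.isSome ∧ x.1.verdict = some .ok ∧
            ∃ b, x.1.masked = some b ∧ i ∈ b.SV) }).1 := by
  simp only [react, andThen, announce_fst, judge_fst, sendPoly_fst, sendPoint_fst]
  rfl

theorem decideOutput_fst (i : Fin n) (st : PState n F) :
    ∃ o, (decideOutput P i st).1 = { st with output := o } ∧ (st.output.isSome → o.isSome) ∧
      (i = P.R → st.revealing → st.masked.isSome → ∀ x, st.verdict = some (.nok x) → o.isSome) ∧
      (i = P.R → st.revealing → ∀ b, st.masked = some b → st.verdict = some .ok →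
        ∀ f, st.revPoly = some f → EnoughAccepted P b f st.revPoint → o.isSome) := by
  unfold decideOutput
  split_ifs with hc
  · split
    · exact ⟨_, rfl, by simp⟩
    · rename_i b f hb hv hf
      split_ifs with he
      · exact ⟨_, rfl, by simp⟩
      · exact ⟨st.output, rfl, by grind⟩
    · rename_i h1 h2
      exact ⟨st.output, rfl, by grind [Option.isSome_iff_exists]⟩
  · refine ⟨st.output, rfl, ?_⟩
    rcases ho : st.output with _ | x
    · grind
    · simp

/-- One pass through the rules suffices because no rule enables another one at the same party. -/
theorem quiescent_react (i : Fin n) (x : PState n F × List (Out n F)) :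
    Quiescent P i (react P s c i x).1 := by
  rw [react_fst_eq]
  obtain ⟨o, ho, -, h2, h3⟩ := decideOutput_fst (P := P) i
      { x.1 with
        announced := x.1.announced ∨
          (i = P.I ∧ x.1.polys.isSome ∧ Finset.univ \ x.1.confirmed ∈ P.Z)
        judged := x.1.judged ∨ (i = P.S ∧ x.1.masked.isSome)
        polySent := x.1.polySent ∨
          (i = P.I ∧ x.1.revealing ∧ ∃ f, x.1.icSig P i = some (.poly f))
        pointSent := x.1.pointSent ∨
          (x.1.revealing ∧ x.1.point.isSome ∧ x.1.verdict = some .ok ∧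
            ∃ b, x.1.masked = some b ∧ i ∈ b.SV) }
  rw [ho]
  refine ⟨fun h h' h'' => .inr ⟨h, h', h''⟩, fun h h' => .inr ⟨h, h'⟩,
    fun h h' h1 h2 h3 => .inr ⟨h, h', ?_⟩, fun h h' h1 b h2 h3 => .inr ⟨h, h', h1, b, h2, h3⟩,
    h2, h3⟩
  obtain ⟨⟨f, e⟩, hq⟩ := Option.isSome_iff_exists.1 h3
  exact ⟨f, PState.icSig_eq_poly.2 ⟨h, h1, h2, e, hq⟩⟩

theorem quiescent_initial (i : Fin n) : Quiescent P i (PState.initial n F) := by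
  constructor <;> simp [PState.initial]

theorem handle_loc (i : Fin n) (x : PState n F × List (Out n F)) :
    (g.handle P Zs s c i x).loc = Function.update g.loc i (react P s c i x).1 :=
  Config.foldl_emit_loc ..

theorem quiescent_apply (h : ∀ i, Quiescent P i (g.loc i)) (a : Action n F) (i : Fin n) :
    Quiescent P i ((g.apply P Zs s c a).loc i) := by
  have key (g' : Config n F) (hg' : g'.loc = g.loc) (j : Fin n)
      (x : PState n F × List (Out n F)) :
      Quiescent P i ((g'.handle P Zs s c j x).loc i) := by
    rw [handle_loc, hg', Function.update_apply]
    split_ifs with hij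
    · subst hij; exact quiescent_react ..
    · exact h i
  rcases a with k | ⟨src, dst, m⟩ | ⟨m | v⟩ | j | j | j | _ <;> simp only [Config.apply]
  · split
    · split_ifs
      · exact h i
      · exact key { g with delivered := insert k g.delivered } rfl _ _
    · exact h i
  all_goals first | exact h i | skip
  all_goals split_ifs
  all_goals first | exact h i | exact key g rfl _ _

variable (P Zs s c) in
theorem quiescent_run (A : Adversary n F) (r : A.Tape) (k : ℕ) (i : Fin n) :
    Quiescent P i ((run P Zs A r s c k).loc i) := by
  induction k generalizing i with
  | zero =>
    obtain ⟨v, hv⟩ := start_eq P Zs s c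
    rw [run, hv]
    exact quiescent_initial i
  | succ k ih =>
    exact quiescent_apply
      (g := { run P Zs A r s c k with view := (run P Zs A r s c k).view ++ [.move _] }) ih _ i

/-! ### Liveness -/

section liveness

variable {A : Adversary n F} {r : A.Tape}

open Filter

/-- A persistent property that holds once holds from then on. Finitely many such properties
therefore hold at one common time, where quiescence can be applied. -/
theorem eventually_run (p : Config n F → Prop)
    (hp : ∀ k l, (run P Zs A r s c k).Le (run P Zs A r s c l) →
      p (run P Zs A r s c k) → p (run P Zs A r s c l))
    (h : ∃ k, p (run P Zs A r s c k)) : ∀ᶠ k in atTop, p (run P Zs A r s c k) := by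
  obtain ⟨k, hk⟩ := h
  filter_upwards [eventually_ge_atTop k] with l hl
  exact hp k l (run_le P Zs s c A r hl) hk

theorem eventually_forall_honest {p : Fin n → ℕ → Prop} (h : ∀ i ∉ Zs, ∀ᶠ k in atTop, p i k) :
    ∀ᶠ k in atTop, ∀ i ∉ Zs, p i k := by
  rw [Filter.eventually_all]
  exact fun i => Filter.eventually_imp_distrib_left.2 (h i)

/-- The invariant `processed` speaks of whatever packet sits at a delivered position. Positions keep
their packets, so comparing two times at their maximum shows that this packet is `p`. -/
theorem eventually_processed (hE : EventualDelivery Zs (run P Zs A r s c)) {k j : ℕ}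
    {p : Packet n F} (hp : (run P Zs A r s c k).packets[j]? = some p) (hs : p.src ∉ Zs)
    (hd : p.dst ∉ Zs) :
    ∀ᶠ l in atTop, Processed P p ((run P Zs A r s c l).loc p.dst) := by
  refine eventually_run (fun g => Processed P p (g.loc p.dst)) (fun _ _ hle h => h.mono hle) ?_
  obtain ⟨k', hk'⟩ := hE.packets k j p hp hs hd
  refine ⟨k', ?_⟩
  obtain ⟨q, hq, hpr⟩ := (inv_run P Zs s c A r k').processed j hk'
  have h1 := (run_le P Zs s c A r (le_max_left k k')).packets _ _ hp
  have h2 := (run_le P Zs s c A r (le_max_right k k')).packets _ _ hq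
  have : p = q := Option.some.inj (h1.symm.trans h2)
  exact this ▸ hpr

theorem eventually_masked (hE : EventualDelivery Zs (run P Zs A r s c)) {b : Masked n F}
    (hb : ∃ k, (run P Zs A r s c k).maskedCast = some b) :
    ∀ᶠ k in atTop, ∀ i ∉ Zs, ((run P Zs A r s c k).loc i).masked = some b := by
  refine eventually_forall_honest fun i hi => ?_
  obtain ⟨k, hk⟩ := hb
  refine eventually_run (fun g => (g.loc i).masked = some b) (fun _ _ hle h => hle.masked _ _ h) ?_
  obtain ⟨k', hk'⟩ := hE.masked k (by simp [hk]) i hi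
  obtain ⟨b', hb'⟩ := Option.isSome_iff_exists.1 hk'
  refine ⟨k', ?_⟩
  have h1 := (run_le P Zs s c A r (le_max_left k k')).maskedCast _ hk
  have h2 := (run_le P Zs s c A r (le_max_right k k')).maskedCast _
    ((inv_run P Zs s c A r k').masked _ _ hb')
  rw [hb', ← h1, ← h2]

theorem eventually_verdict (hE : EventualDelivery Zs (run P Zs A r s c)) {v : Verdict F}
    (hv : ∃ k, (run P Zs A r s c k).verdictCast = some v) :
    ∀ᶠ k in atTop, ∀ i ∉ Zs, ((run P Zs A r s c k).loc i).verdict = some v := by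
  refine eventually_forall_honest fun i hi => ?_
  obtain ⟨k, hk⟩ := hv
  refine eventually_run (fun g => (g.loc i).verdict = some v)
    (fun _ _ hle h => hle.verdict _ _ h) ?_
  obtain ⟨k', hk'⟩ := hE.verdict k (by simp [hk]) i hi
  obtain ⟨v', hv'⟩ := Option.isSome_iff_exists.1 hk'
  refine ⟨k', ?_⟩
  have h1 := (run_le P Zs s c A r (le_max_left k k')).verdictCast _ hk
  have h2 := (run_le P Zs s c A r (le_max_right k k')).verdictCast _
    ((inv_run P Zs s c A r k').verdict _ _ hv')
  rw [hv', ← h1, ← h2]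

theorem eventually_revealing (hr : RevealInvoked Zs (run P Zs A r s c)) :
    ∀ᶠ k in atTop, ∀ i ∉ Zs, ((run P Zs A r s c k).loc i).revealing :=
  eventually_forall_honest fun i hi =>
    eventually_run (fun g => (g.loc i).revealing) (fun _ _ hle h => hle.revealing _ h) (hr i hi)

/-- Quiescence forces some output. The invariant `output` ties it to the verdict held by the
broadcast instance, which leaves only `x`. -/
theorem outputs_secret (hR : P.R ∉ Zs) (hE : EventualDelivery Zs (run P Zs A r s c))
    (hr : RevealInvoked Zs (run P Zs A r s c)) {b : Masked n F} {x : F}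
    (hb : ∃ k, (run P Zs A r s c k).maskedCast = some b)
    (hv : ∃ k, (run P Zs A r s c k).verdictCast = some (.nok x)) :
    Outputs P (run P Zs A r s c) x := by
  obtain ⟨k, h1, h2, h3⟩ := ((eventually_masked hE hb).and
    ((eventually_verdict hE hv).and (eventually_revealing hr))).exists
  have hI := inv_run P Zs s c A r k
  have ho := (quiescent_run P Zs s c A r k P.R).outputSecret rfl (h3 _ hR) (by simp [h1 _ hR]) x
    (h2 _ hR)
  obtain ⟨y, hy⟩ := Option.isSome_iff_exists.1 ho
  obtain ⟨b', -, h | ⟨h, -⟩⟩ := hI.output y hy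
  · rw [hI.verdict _ _ (h2 _ hR)] at h
    simp only [Option.some.injEq, Verdict.nok.injEq] at h
    exact ⟨k, h ▸ hy⟩
  · rw [hI.verdict _ _ (h2 _ hR)] at h
    simp at h

/-- Quiescence makes the intermediary send `f` and every honest supporter send its point. Delivery
brings them to the receiver, and authenticity (`revPoly`, `revPoint`) ensures that these are what it
records. -/
theorem outputs_poly (hZ : IsLowerSet (P.Z : Set (Finset (Fin n)))) (hZs : Zs ∈ P.Z)
    (hI : P.I ∉ Zs) (hR : P.R ∉ Zs) (hE : EventualDelivery Zs (run P Zs A r s c))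
    (hr : RevealInvoked Zs (run P Zs A r s c)) {b : Masked n F} {f h : F[X]}
    (hb : ∃ k, (run P Zs A r s c k).maskedCast = some b)
    (hv : ∃ k, (run P Zs A r s c k).verdictCast = some .ok)
    (hf : ∃ k, ((run P Zs A r s c k).loc P.I).polys = some (f, h))
    (hacc : ∀ j ∈ b.SV, j ∉ Zs →
      ∃ q, (∃ k, ((run P Zs A r s c k).loc j).point = some q) ∧ Accepts b f q) :
    Outputs P (run P Zs A r s c) (f.eval 0) := by
  have hf := eventually_run (fun g => (g.loc P.I).polys = some (f, h))
    (fun _ _ hle h => hle.polys _ _ h) hf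
  have hrev := eventually_revealing hr
  have hm := eventually_masked hE hb
  have hvd := eventually_verdict hE hv
  have hpoly : ∀ᶠ k in atTop, ((run P Zs A r s c k).loc P.R).revPoly = some f := by
    obtain ⟨k, h1, h2, h3, h4⟩ := (hm.and (hvd.and (hrev.and hf))).exists
    obtain ⟨j, f', hj⟩ := (inv_run P Zs s c A r k).polySent
      ((quiescent_run P Zs s c A r k P.I).polySent rfl (h3 _ hI) (by simp [h1 _ hI]) (h2 _ hI)
        (by simp [h4]))
    obtain ⟨-, -, h', hp⟩ := (inv_run P Zs s c A r k).revealPoly j _ f' hj hI rfl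
    obtain rfl : f = f' := by simp_all
    filter_upwards [eventually_processed hE hj hI hR, hf] with l hl hf
    have hl := hl rfl rfl ((inv_run P Zs s c A r l).polys_natDegree _ _ _ hf).1
    obtain ⟨f', hf'⟩ := Option.isSome_iff_exists.1 hl
    obtain ⟨h', hp'⟩ := (inv_run P Zs s c A r l).revPoly hI f' hf'
    simp_all
  have hpoints : ∀ᶠ k in atTop, ∀ j ∉ Zs, j ∈ b.SV →
      ∃ q, ((run P Zs A r s c k).loc P.R).revPoint j = some q ∧ Accepts b f q := by
    refine eventually_forall_honest fun j hj => Filter.eventually_imp_distrib_left.2 fun hjS => ?_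
    obtain ⟨q, hq, hac⟩ := hacc j hjS hj
    have hq := eventually_run (fun g => (g.loc j).point = some q)
      (fun _ _ hle h => hle.point _ _ h) hq
    obtain ⟨k, h1, h2, h3, h4⟩ := (hm.and (hvd.and (hrev.and hq))).exists
    obtain ⟨m, q', hm⟩ := (inv_run P Zs s c A r k).pointSent j
      ((quiescent_run P Zs s c A r k j).pointSent (h3 _ hj) (by simp [h4]) (h2 _ hj) b (h1 _ hj)
        hjS)
    filter_upwards [eventually_processed hE hm hj hR, hq] with l hl hq
    obtain ⟨q'', hq''⟩ := Option.isSome_iff_exists.1 (hl rfl)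
    refine ⟨q'', hq'', ?_⟩
    have := (inv_run P Zs s c A r l).revPoint j q'' hq'' hj
    obtain rfl : q = q'' := by simp_all
    exact hac
  obtain ⟨k, h1, h2, h3, h4, h5⟩ :=
    (hm.and (hvd.and (hrev.and (hpoly.and hpoints)))).exists
  have hIk := inv_run P Zs s c A r k
  -- The accepted set is that of the honest supporters. The rest of `b.SV` lies in `Zs`, hence in
  -- the structure by downward closure.
  have ho := (quiescent_run P Zs s c A r k P.R).outputPoly rfl (h3 _ hR) b (h1 _ hR) (h2 _ hR) f h4
    ⟨b.SV.filter (· ∉ Zs), Finset.filter_subset _ _,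
      hZ (fun j hj => by simp at hj; tauto) (Finset.mem_coe.2 hZs), fun j hj => by
        rw [Finset.mem_filter] at hj
        exact h5 j hj.2 hj.1⟩
  -- The output may have been produced earlier, on the basis of other accepted points; its value is
  -- still that of the unique recorded polynomial at 0.
  obtain ⟨y, hy⟩ := Option.isSome_iff_exists.1 ho
  obtain ⟨b', -, h | ⟨-, f', hf', hy', -⟩⟩ := hIk.output y hy
  · rw [hIk.verdict _ _ (h2 _ hR)] at h
    simp at h
  · obtain rfl : f = f' := by simp_all
    exact ⟨k, hy' ▸ hy⟩

/-! ### Correctness -/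

theorem signPoly_natDegree_le {t : ℕ} (s : F) (c : Coins n t F) : (signPoly s c).natDegree ≤ t := by
  refine (natDegree_add_le _ _).trans (max_le (by simp) ?_)
  refine natDegree_sum_le_of_forall_le _ _ fun i _ => ?_
  exact (natDegree_C_mul_X_pow_le _ _).trans i.2

theorem maskPoly_natDegree_le {t : ℕ} (c : Coins n t F) : (maskPoly c).natDegree ≤ t := by
  refine natDegree_sum_le_of_forall_le _ _ fun i _ => ?_
  exact (natDegree_C_mul_X_pow_le _ _).trans (Nat.lt_succ_iff.1 i.2)

theorem signPoly_eval_zero {t : ℕ} (s : F) (c : Coins n t F) : (signPoly s c).eval 0 = s := by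
  simp [signPoly, eval_finsetSum]

theorem natDegree_masked_le {t : ℕ} {d : F} {f h : F[X]} (hf : f.natDegree ≤ t)
    (hh : h.natDegree ≤ t) : (C d * f + h).natDegree ≤ t :=
  (natDegree_add_le _ _).trans (max_le ((natDegree_C_mul_le _ _).trans hf) hh)

theorem Inv.valid (hg : Inv P Zs s c g) (hS : P.S ∉ Zs) (hI : P.I ∉ Zs) {b : Masked n F}
    (hb : g.maskedCast = some b) : Valid P s c b := by
  obtain ⟨f, h, hp, hd, hB, hSV, -⟩ := hg.maskedCast hI b hb
  obtain ⟨rfl, rfl⟩ := hg.polys hS f h hp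
  refine ⟨hB ▸ natDegree_masked_le (signPoly_natDegree_le s c) (maskPoly_natDegree_le c), hSV,
    fun j _ => ?_⟩
  simp [hB, hd, verPoint]

/-- Confirmations from all honest parties are enough to trigger the announcement, since the
unconfirmed parties are then all corrupt. `Inv.valid` rules out a complaint. At the end honest
points lie on the signing polynomial, so the first acceptance clause holds. -/
theorem correctness (hZ : IsLowerSet (P.Z : Set (Finset (Fin n)))) (hZs : Zs ∈ P.Z)
    (hS : P.S ∉ Zs) (hI : P.I ∉ Zs) (hR : P.R ∉ Zs)
    (hE : EventualDelivery Zs (run P Zs A r s c)) :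
    AllAuthComplete Zs (run P Zs A r s c) ∧
      (RevealInvoked Zs (run P Zs A r s c) → Outputs P (run P Zs A r s c) s) := by
  have h0 : (run P Zs A r s c 0).packets = initialPackets P s c := by
    obtain ⟨v, hv⟩ := start_eq P Zs s c
    simp [run, hv, hS]
  have hpoly : ∀ᶠ k in atTop,
      ((run P Zs A r s c k).loc P.I).polys = some (signPoly s c, maskPoly c) := by
    have := eventually_processed (k := 0) (j := 0)
      (p := ⟨P.S, P.I, .authPoly (signPoly s c) (maskPoly c)⟩) hE (by simp [h0, initialPackets])
      hS hI
    filter_upwards [this] with k hk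
    have := hk rfl rfl (signPoly_natDegree_le s c) (maskPoly_natDegree_le c)
    obtain ⟨⟨f, h⟩, hq⟩ := Option.isSome_iff_exists.1 this
    obtain ⟨rfl, rfl⟩ := (inv_run P Zs s c A r k).polys hS f h hq
    exact hq
  have hpoint : ∀ᶠ k in atTop, ∀ j ∉ Zs,
      ((run P Zs A r s c k).loc j).point = some (verPoint s c j) := by
    refine eventually_forall_honest fun j hj => ?_
    obtain ⟨m, hm⟩ := List.mem_iff_getElem?.1
      (show (⟨P.S, j, .authPoint (verPoint s c j)⟩ : Packet n F) ∈
        (run P Zs A r s c 0).packets by simp [h0, initialPackets])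
    filter_upwards [eventually_processed hE hm hS hj] with k hk
    obtain ⟨q, hq⟩ := Option.isSome_iff_exists.1 (hk rfl)
    exact (inv_run P Zs s c A r k).point hS j q hq ▸ hq
  have hconf : ∀ᶠ k in atTop, ∀ j ∉ Zs, j ∈ ((run P Zs A r s c k).loc P.I).confirmed := by
    refine eventually_forall_honest fun j hj => ?_
    obtain ⟨k, hk⟩ := hpoint.exists
    obtain ⟨m, hm⟩ := (inv_run P Zs s c A r k).confirming j (by simp [hk j hj])
    filter_upwards [eventually_processed hE hm hj hI] with k hk
    exact hk rfl
  obtain ⟨k, h1, h2⟩ := (hpoly.and hconf).exists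
  obtain ⟨b, hb⟩ := Option.isSome_iff_exists.1 <| (inv_run P Zs s c A r k).announced
    ((quiescent_run P Zs s c A r k P.I).announced rfl (by simp [h1])
      (hZ (fun j hj => by_contra fun h => (Finset.mem_sdiff.1 hj).2 (h2 j h)) (Finset.mem_coe.2 hZs)))
  have hm := eventually_masked hE ⟨k, hb⟩
  obtain ⟨l, hl⟩ := hm.exists
  obtain ⟨v, hv⟩ := Option.isSome_iff_exists.1 <| (inv_run P Zs s c A r l).judged
    ((quiescent_run P Zs s c A r l P.S).judged rfl (by simp [hl _ hS]))
  have hok : v = .ok := by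
    have hi := inv_run P Zs s c A r l
    obtain ⟨b', hb', h | ⟨-, h⟩⟩ := hi.verdict_mem_casts v (hi.verdictCast hS v hv)
    · exact h.1
    · exact absurd (hi.valid hS hI hb') h
  subst hok
  have hvd := eventually_verdict hE ⟨l, hv⟩
  refine ⟨fun i hi => ?_, fun hr => ?_⟩
  · obtain ⟨m, h3, h4⟩ := (hm.and hvd).exists
    exact ⟨m, by simp [PState.AuthCompleted, h3 i hi, h4 i hi]⟩
  · have := outputs_poly hZ hZs hI hR hE hr ⟨k, hb⟩ ⟨l, hv⟩ ⟨k, h1⟩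
      fun j _ hj => ⟨_, (hpoint.mono fun k hk => hk j hj).exists, .inl rfl⟩
    rwa [signPoly_eval_zero] at this

end liveness

end invariants

/-! ### Pairs of executions that the adversary cannot distinguish -/

/-- Two inputs of an honest intermediary that lead to the same announcement. -/
def PolySim (t : ℕ) (d : F) (q q' : F[X] × F[X]) : Prop :=
  (q.1.natDegree ≤ t ∧ q.2.natDegree ≤ t ↔ q'.1.natDegree ≤ t ∧ q'.2.natDegree ≤ t) ∧
    C d * q.1 + q.2 = C d * q'.1 + q'.2

/-- Points and revealed polynomials may differ freely between two honest parties, whose content the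
adversary does not see. The signer's polynomials are constrained because the announcement exposes
$dF+M$. Equality of what corrupt parties send or receive is imposed in `PacketSim` and `OutSim`. -/
inductive MsgSim (t : ℕ) (d : F) : Msg F → Msg F → Prop
  | authPoly (f h f' h') (H : PolySim t d (f, h) (f', h')) :
      MsgSim t d (.authPoly f h) (.authPoly f' h')
  | authPoint (q q') : MsgSim t d (.authPoint q) (.authPoint q')
  | received : MsgSim t d .received .received
  | revealPoly (f f') : MsgSim t d (.revealPoly f) (.revealPoly f')
  | revealPoint (q q') : MsgSim t d (.revealPoint q) (.revealPoint q')

theorem MsgSim.refl (t : ℕ) (d : F) (m : Msg F) : MsgSim t d m m := by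
  cases m <;> constructor
  exact ⟨.rfl, rfl⟩

theorem MsgSim.kind {t : ℕ} {d : F} {m m' : Msg F} (h : MsgSim t d m m') : m.kind = m'.kind := by
  cases h <;> rfl

structure PacketSim (t : ℕ) (Zs : Finset (Fin n)) (d : F) (p p' : Packet n F) : Prop where
  src : p.src = p'.src
  dst : p.dst = p'.dst
  msg : MsgSim t d p.msg p'.msg
  eq : p.src ∈ Zs ∨ p.dst ∈ Zs → p.msg = p'.msg

inductive OutSim (t : ℕ) (Zs : Finset (Fin n)) (d : F) : Out n F → Out n F → Prop
  | send (j m m') (h : MsgSim t d m m') (h' : j ∈ Zs → m = m') :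
      OutSim t Zs d (.send j m) (.send j m')
  | cast (b) : OutSim t Zs d (.cast b) (.cast b)

/-- Local states of a party that the adversary cannot distinguish. -/
structure StateSim (P : Session n) (Zs : Finset (Fin n)) (d : F) (st st' : PState n F) : Prop where
  polys : Option.Rel (PolySim P.t d) st.polys st'.polys
  point : st.point = none ↔ st'.point = none
  confirmed : st.confirmed = st'.confirmed
  masked : st.masked = st'.masked
  verdict : st.verdict = st'.verdict
  revealing : st.revealing ↔ st'.revealing
  revPoly : P.I ∈ Zs → st.revPoly = st'.revPoly
  announced : st.announced ↔ st'.announced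
  judged : st.judged ↔ st'.judged
  polySent : st.polySent ↔ st'.polySent
  pointSent : st.pointSent ↔ st'.pointSent

/-- Configurations that the adversary cannot distinguish. -/
structure Sim (P : Session n) (Zs : Finset (Fin n)) (d : F) (g g' : Config n F) : Prop where
  view : g.view = g'.view
  packets : List.Forall₂ (PacketSim P.t Zs d) g.packets g'.packets
  delivered : g.delivered = g'.delivered
  maskedCast : g.maskedCast = g'.maskedCast
  verdictCast : g.verdictCast = g'.verdictCast
  loc : ∀ i ∉ Zs, StateSim P Zs d (g.loc i) (g'.loc i)

/-- The signer has never complained. -/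
def Config.NoNok (g : Config n F) : Prop :=
  ∀ x, .verdict (.nok x) ∉ g.casts

section simulation

variable {P : Session n} {Zs : Finset (Fin n)} {d : F} {g g' : Config n F}

theorem Config.mem_casts_commit {i : Fin n} {x : PState n F × List (Out n F)} {b : Cast n F} :
    b ∈ (g.commit Zs i x).casts ↔ b ∈ g.casts ∨ .cast b ∈ x.2 := by
  have key (l : List (Out n F)) (g : Config n F) :
      b ∈ (l.foldl (Config.emit Zs i) g).casts ↔ b ∈ g.casts ∨ .cast b ∈ l := by
    induction l generalizing g with
    | nil => simp
    | cons o l ih =>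
      rw [List.foldl_cons, ih]
      rcases o with ⟨j, m⟩ | ⟨m | v⟩ <;> simp [Config.emit, Config.addCast, or_assoc]
  exact key _ _

theorem Config.NoNok.of_commit {i : Fin n} {x : PState n F × List (Out n F)}
    (h : (g.commit Zs i x).NoNok) : g.NoNok :=
  fun y hy => h y (Config.mem_casts_commit.2 (.inl hy))

theorem Sim.emit {i : Fin n} (h : Sim P Zs d g g') {o o' : Out n F} (ho : OutSim P.t Zs d o o')
    (hi : i ∉ Zs) : Sim P Zs d (Config.emit Zs i g o) (Config.emit Zs i g' o') := by
  rcases ho with ⟨j, m, m', hm, hm'⟩ | b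
  · refine ⟨?_, ?_, h.delivered, h.maskedCast, h.verdictCast, h.loc⟩
    · simp only [Config.emit, h.view, hm.kind]
      split_ifs with hj
      · rw [hm' hj]
      · rfl
    · exact List.rel_append h.packets (.cons ⟨rfl, rfl, hm, fun H => hm' (H.resolve_left hi)⟩ .nil)
  · rcases b with m | v
    · exact ⟨by simp [Config.emit, h.view], h.packets, h.delivered,
        by simp [Config.emit, Config.addCast, h.maskedCast], h.verdictCast, h.loc⟩
    · exact ⟨by simp [Config.emit, h.view], h.packets, h.delivered, h.maskedCast,
        by simp [Config.emit, Config.addCast, h.verdictCast], h.loc⟩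

theorem Sim.foldl_emit {i : Fin n} (h : Sim P Zs d g g') {o o' : List (Out n F)}
    (ho : List.Forall₂ (OutSim P.t Zs d) o o') (hi : i ∉ Zs) :
    Sim P Zs d (o.foldl (Config.emit Zs i) g) (o'.foldl (Config.emit Zs i) g') := by
  induction ho generalizing g g' with
  | nil => exact h
  | cons ha _ ih => exact ih (h.emit ha hi)

/-- Related results of a rule. -/
def ResSim (P : Session n) (Zs : Finset (Fin n)) (d : F) (x x' : PState n F × List (Out n F)) :
    Prop :=
  StateSim P Zs d x.1 x'.1 ∧ List.Forall₂ (OutSim P.t Zs d) x.2 x'.2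

theorem Sim.commit {i : Fin n} (h : Sim P Zs d g g') {x x' : PState n F × List (Out n F)}
    (hx : ResSim P Zs d x x') (hi : i ∉ Zs) :
    Sim P Zs d (g.commit Zs i x) (g'.commit Zs i x') := by
  unfold Config.commit
  refine Sim.foldl_emit (g := { g with loc := Function.update g.loc i x.1 })
    (g' := { g' with loc := Function.update g'.loc i x'.1 }) { h with loc := ?_ } hx.2 hi
  intro j hj
  simp only [Function.update_apply]
  split_ifs
  · exact hx.1
  · exact h.loc j hj

theorem Sim.fire {i : Fin n} (h : Sim P Zs d g g')
    {r r' : PState n F → PState n F × List (Out n F)}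
    (hr : ∀ st st', StateSim P Zs d st st' → ResSim P Zs d (r st) (r' st'))
    (hi : i ∉ Zs) : Sim P Zs d (g.fire Zs i r) (g'.fire Zs i r') :=
  h.commit (hr _ _ (h.loc i hi)) hi

/-! ### Preservation of indistinguishability by rules, moves and executions -/

section rules

variable {st st' : PState n F} {s s' : F} {c c' : Coins n P.t F}

theorem ResSim.ite {p p' : Prop} {_ : Decidable p} {_ : Decidable p'}
    {x x' y y' : PState n F × List (Out n F)} (hp : p ↔ p') (hx : p → ResSim P Zs d x x')
    (hy : ResSim P Zs d y y') :
    ResSim P Zs d (if p then x else y) (if p' then x' else y') := by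
  by_cases h : p
  · rw [if_pos h, if_pos (hp.1 h)]
    exact hx h
  · rw [if_neg h, if_neg (mt hp.2 h)]
    exact hy

theorem StateSim.polys_eq_none (h : StateSim P Zs d st st') :
    st.polys = none ↔ st'.polys = none := by
  have : ∀ {a b : Option (F[X] × F[X])}, Option.Rel (PolySim P.t d) a b →
      (a = none ↔ b = none) := by
    rintro _ _ (⟨-⟩ | -) <;> simp
  exact this h.polys

/-- A revealed polynomial is recorded only if it comes from the intermediary. If that party is
corrupt, both runs contain the same message; otherwise the records need not be related. -/
theorem StateSim.receive (h : StateSim P Zs d st st') {i src : Fin n} {m m' : Msg F}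
    (hm : MsgSim P.t d m m') (hs : src ∈ Zs → m = m') :
    ResSim P Zs d (receive P i src m st) (receive P i src m' st') := by
  rcases hm with ⟨f, e, f', e', H⟩ | ⟨q, q'⟩ | - | ⟨f, f'⟩ | ⟨q, q'⟩ <;>
    simp only [AICP.receive]
  · refine .ite ?_ (fun _ => ⟨{ h with polys := .some H }, .nil⟩) ⟨h, .nil⟩
    have H' := H.1
    rw [h.polys_eq_none]
    tauto
  · refine .ite (by rw [h.point]) (fun _ => ⟨{ h with point := by simp }, ?_⟩) ⟨h, .nil⟩
    exact .cons (.send _ _ _ .received fun _ => rfl) .nil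
  · exact .ite .rfl (fun _ => ⟨{ h with confirmed := by simp [h.confirmed] }, .nil⟩) ⟨h, .nil⟩
  · by_cases hI : P.I ∈ Zs
    · rw [h.revPoly hI]
      by_cases hsrc : src = P.I
      · have := hs (hsrc ▸ hI)
        obtain rfl : f = f' := by simpa using this
        exact .ite .rfl (fun _ => ⟨{ h with revPoly := fun _ => rfl }, .nil⟩) ⟨h, .nil⟩
      · rw [if_neg (by tauto), if_neg (by tauto)]
        exact ⟨h, .nil⟩
    · split_ifs <;> exact ⟨{ h with revPoly := fun H => absurd H hI }, .nil⟩
  · split_ifs <;> exact ⟨{ h with }, .nil⟩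

/-- The polynomials may differ, but `PolySim` and the common combiner make the broadcasts literally
equal. -/
theorem StateSim.announce (h : StateSim P Zs (combiner c) st st') {i : Fin n}
    (hc : combiner c' = combiner c) :
    ResSim P Zs (combiner c) (announce P c i st) (announce P c' i st') := by
  unfold AICP.announce
  have hp := h.polys
  rcases hp₁ : st.polys with _ | ⟨f, e⟩ <;> rcases hp₂ : st'.polys with _ | ⟨f', e'⟩ <;>
    rw [hp₁, hp₂] at hp <;> rcases hp with ⟨H⟩ | -
  · exact ⟨h, .nil⟩
  · refine .ite (by rw [h.announced, h.confirmed])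
      (fun _ => ⟨{ h with announced := .rfl, polys := .some H }, ?_⟩) ⟨h, .nil⟩
    have H' := H.2
    rw [hc, h.confirmed, H']
    exact .cons (.cast _) .nil

/-- The verdict is the one place where hidden coins could become visible. Excluding complaints on
both sides leaves `OK` in both runs, although validity itself is not shown to transfer. -/
theorem StateSim.judge (h : StateSim P Zs d st st') {i : Fin n}
    (hn : ∀ x, .cast (.verdict (.nok x)) ∉ (judge P s c i st).2)
    (hn' : ∀ x, .cast (.verdict (.nok x)) ∉ (judge P s' c' i st').2) :
    ResSim P Zs d (judge P s c i st) (judge P s' c' i st') := by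
  unfold AICP.judge at hn hn' ⊢
  rcases hm : st.masked with _ | b <;> have hm' := hm <;> rw [h.masked] at hm' <;>
    simp only [hm, hm'] at hn hn' ⊢
  · exact ⟨h, .nil⟩
  · refine .ite (by rw [h.judged]) (fun hj => ⟨{ h with judged := .rfl, masked := rfl }, ?_⟩)
      ⟨h, .nil⟩
    rw [if_pos hj] at hn
    rw [if_pos (by rwa [← h.judged])] at hn'
    split_ifs at hn hn' ⊢
    · exact .cons (.cast _) .nil
    · exact absurd (by simp) (hn' s')
    · exact absurd (by simp) (hn s)
    · exact absurd (by simp) (hn s)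

/-- Whether something is sent depends only on related data. What is sent goes to an honest receiver
and may differ. -/
theorem StateSim.sendPoly (h : StateSim P Zs d st st') {i : Fin n} (hR : P.R ∉ Zs) :
    ResSim P Zs d (sendPoly P i st) (sendPoly P i st') := by
  have key : (∃ f, st.icSig P i = some (.poly f)) ↔ ∃ f, st'.icSig P i = some (.poly f) := by
    have := h.polys_eq_none
    simp only [PState.icSig_eq_poly, ← h.masked, ← h.verdict]
    revert this
    rcases st.polys with _ | ⟨f, e⟩ <;> rcases st'.polys with _ | ⟨f', e'⟩ <;> simp_all
  unfold AICP.sendPoly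
  split
  · rename_i f hf
    obtain ⟨f', hf'⟩ := key.1 ⟨f, hf⟩
    rw [hf']
    exact .ite (by rw [h.revealing, h.polySent]) (fun _ => ⟨{ h with polySent := .rfl },
      .cons (.send _ _ _ (.revealPoly _ _) fun H => absurd H hR) .nil⟩) ⟨h, .nil⟩
  · rename_i hf
    split
    · rename_i f' hf'
      obtain ⟨f, hf''⟩ := key.2 ⟨f', hf'⟩
      exact absurd hf'' (hf f)
    · exact ⟨h, .nil⟩

theorem StateSim.sendPoint (h : StateSim P Zs d st st') {i : Fin n} (hR : P.R ∉ Zs) :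
    ResSim P Zs d (sendPoint P i st) (sendPoint P i st') := by
  have hp := h.point
  unfold AICP.sendPoint
  split
  · rename_i b q hb hv hq
    obtain ⟨q', hq'⟩ := Option.ne_none_iff_exists'.1 (mt hp.2 (by simp [hq]))
    have hb' := h.masked.symm.trans hb
    have hv' := h.verdict.symm.trans hv
    simp only [hb', hv', hq']
    exact .ite (by rw [h.revealing, h.pointSent])
      (fun _ => ⟨{ h with pointSent := .rfl, point := by simp [hq], masked := hb, verdict := hv },
      .cons (.send _ _ _ (.revealPoint _ _) fun H => absurd H hR) .nil⟩) ⟨h, .nil⟩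
  · rename_i hn
    split
    · rename_i b q' hb hv hq
      obtain ⟨q, hq⟩ := Option.ne_none_iff_exists'.1 (mt hp.1 (by simp [hq]))
      exact absurd hq (hn b q (h.masked.trans hb) (h.verdict.trans hv))
    · exact ⟨h, .nil⟩

theorem decideOutput_eq (P : Session n) (i : Fin n) (st : PState n F) :
    ∃ o, decideOutput P i st = ({ st with output := o }, []) := by
  unfold decideOutput
  split_ifs
  · split
    · exact ⟨_, rfl⟩
    · split_ifs
      · exact ⟨_, rfl⟩
      · exact ⟨_, rfl⟩
    · exact ⟨_, rfl⟩
  · exact ⟨_, rfl⟩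

/-- The two runs may decide differently: the decision emits nothing, and `StateSim` does not
constrain `output`. -/
theorem StateSim.decideOutput (h : StateSim P Zs d st st') {i : Fin n} :
    ResSim P Zs d (decideOutput P i st) (decideOutput P i st') := by
  obtain ⟨o, ho⟩ := decideOutput_eq P i st
  obtain ⟨o', ho'⟩ := decideOutput_eq P i st'
  rw [ho, ho']
  exact ⟨{ h with }, .nil⟩

theorem Sim.handle (h : Sim P Zs (combiner c) g g') (hc : combiner c' = combiner c)
    (hR : P.R ∉ Zs) {i : Fin n} (hi : i ∉ Zs) {x x' : PState n F × List (Out n F)}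
    (hx : ResSim P Zs (combiner c) x x') (hn : (g.handle P Zs s c i x).NoNok)
    (hn' : (g'.handle P Zs s' c' i x').NoNok) :
    Sim P Zs (combiner c) (g.handle P Zs s c i x) (g'.handle P Zs s' c' i x') := by
  rw [Config.handle_eq] at hn hn'
  rw [Config.handle_eq, Config.handle_eq]
  -- Undoes the three rules that follow the verdict. Casts are never removed, so absence of
  -- complaints at the end gives absence just after `judge`.
  have hn := hn.of_commit.of_commit.of_commit
  have hn' := hn'.of_commit.of_commit.of_commit
  have h1 := Sim.fire (h.commit hx hi) (fun _ _ h => StateSim.announce (i := i) h hc) hi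
  have h2 := h1.commit ((h1.loc i hi).judge
    (fun y hy => hn y (Config.mem_casts_commit.2 (.inr hy)))
    (fun y hy => hn' y (Config.mem_casts_commit.2 (.inr hy)))) hi
  have h3 := Sim.fire h2 (fun _ _ h => StateSim.sendPoly (i := i) h hR) hi
  have h4 := Sim.fire h3 (fun _ _ h => StateSim.sendPoint (i := i) h hR) hi
  exact Sim.fire h4 (fun _ _ h => StateSim.decideOutput (i := i) h) hi

theorem Sim.apply (h : Sim P Zs (combiner c) g g') (hc : combiner c' = combiner c)
    (hR : P.R ∉ Zs) (a : Action n F) (hn : (g.apply P Zs s c a).NoNok)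
    (hn' : (g'.apply P Zs s' c' a).NoNok) :
    Sim P Zs (combiner c) (g.apply P Zs s c a) (g'.apply P Zs s' c' a) := by
  rcases a with k | ⟨src, dst, m⟩ | ⟨m | v⟩ | i | i | i | _ <;>
    simp only [Config.apply] at hn hn' ⊢
  · rcases hk : g.packets[k]? with _ | p <;> rcases hk' : g'.packets[k]? with _ | p' <;>
      simp only [hk, hk'] at hn hn' ⊢
    · exact h
    · simp only [List.getElem?_eq_none_iff] at hk
      have := (List.getElem?_eq_some_iff.1 hk').1
      have := h.packets.length_eq
      omega
    · have := (List.getElem?_eq_some_iff.1 hk).1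
      have := h.packets.length_eq
      simp at hk'
      omega
    · have hp : PacketSim P.t Zs (combiner c) p p' := by
        obtain ⟨h1, rfl⟩ := List.getElem?_eq_some_iff.1 hk
        obtain ⟨h2, rfl⟩ := List.getElem?_eq_some_iff.1 hk'
        simpa using h.packets.get h1 h2
      rw [← h.delivered, ← hp.dst, ← hp.src] at hn' ⊢
      split_ifs at hn hn' ⊢ with hd
      · exact h
      · rw [not_or] at hd
        have h' : Sim P Zs (combiner c) { g with delivered := insert k g.delivered }
            { g' with delivered := insert k g.delivered } := { h with delivered := rfl }
        exact h'.handle hc hR hd.2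
          ((h.loc _ hd.2).receive hp.msg fun hs => hp.eq (.inl hs)) hn hn'
  · split_ifs with hs
    · exact { h with
        packets := List.rel_append h.packets (.cons ⟨rfl, rfl, .refl _ _ _, fun _ => rfl⟩ .nil) }
    · exact h
  · split_ifs
    · exact { h with maskedCast := by simp [Config.addCast, h.maskedCast] }
    · exact h
  · split_ifs
    · exact { h with verdictCast := by simp [Config.addCast, h.verdictCast] }
    · exact h
  · rw [← h.maskedCast] at hn' ⊢
    split_ifs at hn hn' ⊢ with hi
    · exact h
    · rw [not_or] at hi
      exact h.handle hc hR hi.1 ⟨{ h.loc i hi.1 with masked := rfl }, .nil⟩ hn hn'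
  · rw [← h.verdictCast] at hn' ⊢
    split_ifs at hn hn' ⊢ with hi
    · exact h
    · rw [not_or] at hi
      exact h.handle hc hR hi.1 ⟨{ h.loc i hi.1 with verdict := rfl }, .nil⟩ hn hn'
  · split_ifs at hn hn' ⊢ with hi
    · exact h
    · exact h.handle hc hR hi ⟨{ h.loc i hi with revealing := .rfl }, .nil⟩ hn hn'
  · exact h

/-- Inputs and coins for which an honest signer sends the same to the corrupt parties, and an honest
intermediary announces the same. -/
structure Coupled (P : Session n) (Zs : Finset (Fin n)) (s : F) (c : Coins n P.t F) (s' : F)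
    (c' : Coins n P.t F) : Prop where
  combiner_eq : combiner c' = combiner c
  masked : C (combiner c) * signPoly s c + maskPoly c =
    C (combiner c) * signPoly s' c' + maskPoly c'
  points : ∀ j ∈ Zs, verPoint s c j = verPoint s' c' j
  polys : P.I ∈ Zs → signPoly s c = signPoly s' c' ∧ maskPoly c = maskPoly c'

theorem Coupled.start (h : Coupled P Zs s c s' c') (hS : P.S ∉ Zs) :
    Sim P Zs (combiner c) (start P Zs s c) (start P Zs s' c') := by
  unfold AICP.start distribute
  rw [if_neg hS, if_neg hS]
  refine Sim.foldl_emit ⟨rfl, .nil, rfl, rfl, rfl, fun i _ => ?_⟩ (.cons ?_ ?_) hS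
  · exact ⟨.none, .rfl, rfl, rfl, rfl, .rfl, fun _ => rfl, .rfl, .rfl, .rfl, .rfl⟩
  · refine .send _ _ _ (.authPoly _ _ _ _ ⟨?_, h.masked⟩) fun hI => by
      rw [(h.polys hI).1, (h.polys hI).2]
    simp [signPoly_natDegree_le, maskPoly_natDegree_le]
  · rw [List.forall₂_map_left_iff, List.forall₂_map_right_iff]
    exact List.forall₂_same.2 fun j _ => .send _ _ _ (.authPoint _ _) fun hj => by
      rw [h.points j hj]

theorem Coupled.run (h : Coupled P Zs s c s' c') (hS : P.S ∉ Zs) (hR : P.R ∉ Zs)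
    {A : Adversary n F} {r : A.Tape} (hn : ∀ k, (run P Zs A r s c k).NoNok)
    (hn' : ∀ k, (run P Zs A r s' c' k).NoNok) (k : ℕ) :
    Sim P Zs (combiner c) (run P Zs A r s c k) (run P Zs A r s' c' k) := by
  induction k with
  | zero => exact h.start hS
  | succ k ih =>
    have hn := hn (k + 1)
    have hn' := hn' (k + 1)
    simp only [AICP.run] at hn hn' ⊢
    -- Equal views make the adversary choose the same move in both runs.
    rw [← ih.view] at hn' ⊢
    have ih' : Sim P Zs (combiner c)
        { AICP.run P Zs A r s c k with
          view := (AICP.run P Zs A r s c k).view ++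
            [.move (A.next r (AICP.run P Zs A r s c k).view)] }
        { AICP.run P Zs A r s' c' k with
          view := (AICP.run P Zs A r s c k).view ++
            [.move (A.next r (AICP.run P Zs A r s c k).view)] } := { ih with view := rfl }
    exact ih'.apply h.combiner_eq hR _ hn hn'

end rules

end simulation

/-! ### Privacy -/

section privacy

variable {P : Session n} {Zs : Finset (Fin n)} {s : F} {c : Coins n P.t F}

theorem Config.NoNok.of_honest {g : Config n F} (hg : Inv P Zs s c g) (hS : P.S ∉ Zs)
    (hI : P.I ∉ Zs) : g.NoNok := by
  intro x hx
  obtain ⟨b, hb, h | h⟩ := hg.verdict_mem_casts _ hx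
  · exact absurd h.1 (by simp)
  · exact h.2 (hg.valid hS hI hb)

/-- The polynomial with value `δ` at `0` that vanishes at the evaluation points of the parties in
`Zs`. -/
noncomputable def shiftPoly {t : ℕ} (Zs : Finset (Fin n)) (δ : F) (c : Coins n t F) : F[X] :=
  C δ * ∏ j ∈ Zs, (1 - C (c.2.2.1 j : F)⁻¹ * X)

theorem shiftPoly_eval_zero {t : ℕ} (Zs : Finset (Fin n)) (δ : F) (c : Coins n t F) :
    (shiftPoly Zs δ c).eval 0 = δ := by
  simp [shiftPoly, eval_prod]

theorem shiftPoly_eval {t : ℕ} {Zs : Finset (Fin n)} (δ : F) (c : Coins n t F) {j : Fin n}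
    (hj : j ∈ Zs) : (shiftPoly Zs δ c).eval (c.2.2.1 j : F) = 0 := by
  simp only [shiftPoly, eval_mul, eval_prod, mul_eq_zero]
  exact .inr (Finset.prod_eq_zero hj (by simp))

theorem shiftPoly_natDegree_le {t : ℕ} {Zs : Finset (Fin n)} (h : Zs.card ≤ t) (δ : F)
    (c : Coins n t F) : (shiftPoly Zs δ c).natDegree ≤ t := by
  refine (natDegree_C_mul_le _ _).trans ((natDegree_prod_le _ _).trans (le_trans ?_ h))
  refine (Finset.sum_le_card_nsmul _ _ 1 fun j _ => ?_).trans (by simp)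
  refine (natDegree_sub_le _ _).trans (max_le (by simp) ?_)
  exact (natDegree_C_mul_le _ _).trans natDegree_X_le

theorem sum_coeff_fin {t : ℕ} {p : F[X]} (h : p.natDegree ≤ t) :
    ∑ i : Fin (t + 1), C (p.coeff i) * X ^ (i : ℕ) = p := by
  rw [Fin.sum_univ_eq_sum_range (fun i => C (p.coeff i) * X ^ i)]
  exact (as_sum_range_C_mul_X_pow' p (Nat.lt_succ_iff.2 h)).symm

/-- Coins with which the adversary sees the same, when the input is changed by `δ`. -/
noncomputable def shiftCoins {t : ℕ} (Zs : Finset (Fin n)) (δ : F) (c : Coins n t F) :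
    Coins n t F :=
  (fun i => c.1 i + (shiftPoly Zs δ c).coeff (i + 1),
    fun i => c.2.1 i - combiner c * (shiftPoly Zs δ c).coeff i, c.2.2)

theorem signPoly_shiftCoins {t : ℕ} {Zs : Finset (Fin n)} (h : Zs.card ≤ t) (s δ : F)
    (c : Coins n t F) :
    signPoly (s + δ) (shiftCoins Zs δ c) = signPoly s c + shiftPoly Zs δ c := by
  conv_rhs => rw [← sum_coeff_fin (shiftPoly_natDegree_le h δ c), Fin.sum_univ_succ]
  simp only [signPoly, shiftCoins, C_add, add_mul, Finset.sum_add_distrib, Fin.val_succ,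
    Fin.val_zero, pow_zero, mul_one, coeff_zero_eq_eval_zero, shiftPoly_eval_zero]
  ring

theorem maskPoly_shiftCoins {t : ℕ} {Zs : Finset (Fin n)} (h : Zs.card ≤ t) (δ : F)
    (c : Coins n t F) :
    maskPoly (shiftCoins Zs δ c) = maskPoly c - C (combiner c) * shiftPoly Zs δ c := by
  conv_rhs => rw [← sum_coeff_fin (shiftPoly_natDegree_le h δ c)]
  simp only [maskPoly, shiftCoins, C_sub, C_mul, sub_mul, Finset.sum_sub_distrib, Finset.mul_sum,
    mul_assoc]

/-- The shift depends only on the evaluation points and the combiner, which it leaves alone, so the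
added coefficients can be subtracted again. -/
theorem shiftCoins_injective {t : ℕ} (Zs : Finset (Fin n)) (δ : F) :
    Function.Injective (shiftCoins (t := t) Zs δ) := by
  intro c c' h
  have h3 : c.2.2 = c'.2.2 := congrArg (fun x => x.2.2) h
  have hp : shiftPoly Zs δ c = shiftPoly Zs δ c' := by simp [shiftPoly, h3]
  have hd : combiner c = combiner c' := by simp [combiner, h3]
  have h1 := congrArg (fun x => x.1) h
  have h2 := congrArg (fun x => x.2.1) h
  simp only [shiftCoins, hp, hd, funext_iff, add_left_inj, sub_left_inj] at h1 h2
  exact Prod.ext (funext h1) (Prod.ext (funext h2) h3)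

/-- The changes $d\Delta$ and $-d\Delta$ cancel in $dF+M$, and $\Delta$ vanishes at the corrupt
evaluation points. The bound on `Zs.card` keeps $\Delta$ within degree $t$. -/
theorem coupled_shiftCoins (hZs : Zs.card ≤ P.t) (hI : P.I ∉ Zs) (s δ : F) (c : Coins n P.t F) :
    Coupled P Zs s c (s + δ) (shiftCoins Zs δ c) where
  combiner_eq := rfl
  masked := by
    rw [signPoly_shiftCoins hZs, maskPoly_shiftCoins hZs]
    ring
  points j hj := by
    have h : ((shiftCoins Zs δ c).2.2.1 j : F) = c.2.2.1 j := rfl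
    simp [verPoint, h, signPoly_shiftCoins hZs, maskPoly_shiftCoins hZs, shiftPoly_eval δ c hj]
  polys h := absurd h hI

theorem map_uniformOfFintype_of_bijective {α : Type*} [Fintype α] [Nonempty α] {φ : α → α}
    (hφ : Function.Bijective φ) :
    (PMF.uniformOfFintype α).map φ = PMF.uniformOfFintype α := by
  ext a
  obtain ⟨b, rfl⟩ := hφ.2 a
  rw [PMF.map_apply, tsum_eq_single b]
  · simp
  · intro b' hb'
    rw [if_neg fun h => hb' (hφ.1 h).symm]

/-- Shifting the coins by `s' - s` preserves the uniform distribution and carries each run with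
input `s` to a run with input `s'` that has the same view at every time. -/
theorem privacy [Fintype F] [DecidableEq F] {A : Adversary n F} {r : A.Tape} (hZs : Zs ∈ P.Z)
    (hS : P.S ∉ Zs) (hI : P.I ∉ Zs) (hR : P.R ∉ Zs) (s s' : F) :
    (coinDist n P.t F).map (fun c k => (run P Zs A r s c k).view) =
      (coinDist n P.t F).map (fun c k => (run P Zs A r s' c k).view) := by
  have hcard : Zs.card ≤ P.t := Finset.le_sup (f := Finset.card) hZs
  have hbij := Finite.injective_iff_bijective.1 (shiftCoins_injective (t := P.t) Zs (s' - s))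
  conv_rhs => rw [coinDist, ← map_uniformOfFintype_of_bijective hbij, PMF.map_comp]
  congr 1
  funext c k
  have hc := coupled_shiftCoins hcard hI s (s' - s) c
  rw [add_sub_cancel] at hc
  exact (hc.run hS hR (fun k => .of_honest (inv_run P Zs s c A r k) hS hI)
    (fun k => .of_honest (inv_run P Zs s' _ A r k) hS hI) k).view

end privacy

/-! ### Counting coins -/

section counting

/-- If `u g x` replaces the component `π x` of `x` by `g`, and `ρ x` does not depend on this
component, then the component lies in `ρ x` with probability at most `m / |G|`. -/
theorem card_mul_le_of_resample {X G : Type*} [Fintype X] [Fintype G] [DecidableEq G]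
    {π : X → G}
    {u : G → X → X} (hπ : ∀ g x, π (u g x) = g) (hu : ∀ x, u (π x) x = x)
    (huu : ∀ g h x, u g (u h x) = u g x) {ρ : X → Finset G} (hρ : ∀ g x, ρ (u g x) = ρ x) {m : ℕ}
    (hm : ∀ x, (ρ x).card ≤ m) :
    (Finset.univ.filter fun x => π x ∈ ρ x).card * Fintype.card G ≤ m * Fintype.card X := by
  have h1 : ((Finset.univ.filter fun x => π x ∈ ρ x) ×ˢ (Finset.univ : Finset G)).card ≤
      ((Finset.univ : Finset X).sigma ρ).card := by
    -- Resample the component but remember its old value. The new component reveals `g`, and putting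
    -- the old one back recovers `x`. The old value lies in `ρ (u g x)` because `ρ` ignores the
    -- component.
    refine Finset.card_le_card_of_injOn (fun p => ⟨u p.2 p.1, π p.1⟩) ?_ ?_
    · rintro ⟨x, g⟩ hx
      simpa [hρ] using hx
    · rintro ⟨x, g⟩ - ⟨y, h⟩ - hxy
      simp only [Sigma.mk.injEq, heq_eq_eq] at hxy
      have hg : g = h := by rw [← hπ g x, hxy.1, hπ]
      have hxy' : x = y := by rw [← hu x, ← huu _ g x, hxy.1, hxy.2, huu, hu]
      rw [hg, hxy']
  rw [Finset.card_product, Finset.card_univ, Finset.card_sigma] at h1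
  refine h1.trans ((Finset.sum_le_card_nsmul _ _ m fun x _ => hm x).trans ?_)
  simp [mul_comm]

/-- A union bound over the `n` components, each uniform on the `|F| - 1` units and independent of
its own set of bad values. -/
theorem prob_le_of_resample [Fintype F] [DecidableEq F] {t m : ℕ} {E : Set (Coins n t F)}
    {π : Fin n → Coins n t F → Fˣ} {u : Fin n → Fˣ → Coins n t F → Coins n t F}
    (hπ : ∀ j g x, π j (u j g x) = g) (hu : ∀ j x, u j (π j x) x = x)
    (huu : ∀ j g h x, u j g (u j h x) = u j g x) {ρ : Coins n t F → Fin n → Finset Fˣ}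
    (hρ : ∀ j g x, ρ (u j g x) j = ρ x j) (hm : ∀ x j, (ρ x j).card ≤ m)
    (hE : ∀ c ∈ E, ∃ j, π j c ∈ ρ c j) :
    prob E ≤ ENNReal.ofReal ((n * m : ℝ) / ((Fintype.card F : ℝ) - 1)) := by
  classical
  have hcard : E.toFinset.card * Fintype.card Fˣ ≤ n * m * Fintype.card (Coins n t F) := by
    have h1 : E.toFinset ⊆ Finset.univ.biUnion fun j =>
        Finset.univ.filter fun x => π j x ∈ ρ x j := by
      intro c hc
      simpa using hE c (by simpa using hc)
    calc E.toFinset.card * Fintype.card Fˣ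
        ≤ (∑ j : Fin n, (Finset.univ.filter fun x => π j x ∈ ρ x j).card) * Fintype.card Fˣ :=
          Nat.mul_le_mul_right _ ((Finset.card_le_card h1).trans Finset.card_biUnion_le)
      _ = ∑ j : Fin n, (Finset.univ.filter fun x => π j x ∈ ρ x j).card * Fintype.card Fˣ :=
          Finset.sum_mul ..
      _ ≤ ∑ j : Fin n, m * Fintype.card (Coins n t F) :=
          Finset.sum_le_sum fun j _ => card_mul_le_of_resample (hπ j) (hu j) (huu j)
            (ρ := fun x => ρ x j) (hρ j) fun x => hm x j
      _ = n * m * Fintype.card (Coins n t F) := by simp [mul_assoc]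
  have hq : (Fintype.card Fˣ : ℝ) = (Fintype.card F : ℝ) - 1 := by
    rw [Fintype.card_units, Nat.cast_sub Fintype.card_pos, Nat.cast_one]
  rw [prob, coinDist, PMF.toOuterMeasure_uniformOfFintype_apply, ← hq, ← Set.toFinset_card]
  have hX : (0 : ℝ) < Fintype.card (Coins n t F) := by exact_mod_cast Fintype.card_pos
  have hG : (0 : ℝ) < Fintype.card Fˣ := by exact_mod_cast Fintype.card_pos
  rw [← ENNReal.ofReal_natCast, ← ENNReal.ofReal_natCast, ← ENNReal.ofReal_div_of_pos hX]
  refine ENNReal.ofReal_le_ofReal ?_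
  rw [div_le_div_iff₀ hX hG]
  exact_mod_cast hcard

theorem card_units_roots_le [Fintype F] [DecidableEq F] {t : ℕ} {h : F[X]} (h0 : h ≠ 0)
    (ht : h.natDegree ≤ t) : (Finset.univ.filter fun x : Fˣ => h.eval (x : F) = 0).card ≤ t := by
  refine le_trans ?_ ((Multiset.toFinset_card_le h.roots).trans ((card_roots' h).trans ht))
  refine Finset.card_le_card_of_injOn (fun x => (x : F)) ?_ (Units.val_injective.injOn)
  intro x hx
  simpa [h0] using hx

end counting

/-! ### Unforgeability -/

section unforgeability

variable {P : Session n} {Zs : Finset (Fin n)} {s : F} {c : Coins n P.t F}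
  {A : Adversary n F} {r : A.Tape}

theorem exists_honest_of_qCond {Z : Finset (Finset (Fin n))} (hQ : QCond 3 Finset.univ Z)
    {X Y : Finset (Fin n)} (hX : X ∈ Z) (hY : Y ∈ Z) (hZs : Zs ∈ Z) :
    ∃ j, j ∉ X ∧ j ∉ Y ∧ j ∉ Zs := by
  by_contra! h
  refine hQ ![X, Y, Zs] (fun i => by fin_cases i <;> assumption) fun j _ => ?_
  simp only [Finset.mem_biUnion, Finset.mem_univ, true_and]
  by_cases h1 : j ∈ X
  · exact ⟨0, h1⟩
  · by_cases h2 : j ∈ Y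
    · exact ⟨1, h2⟩
    · exact ⟨2, h j h1 h2⟩

/-- What has happened if the receiver outputs a wrong value although the signer is honest. -/
theorem exists_root_of_outputs_ne (hQ : QCond 3 Finset.univ P.Z) (hZs : Zs ∈ P.Z) (hS : P.S ∉ Zs)
    {x : F} (hx : Outputs P (run P Zs A r s c) x) (hne : x ≠ s) :
    (∀ k, (run P Zs A r s c k).NoNok) ∧
      ∃ k b f, (run P Zs A r s c k).maskedCast = some b ∧
        ((run P Zs A r s c k).loc P.R).revPoly = some f ∧ Valid P s c b ∧ f.eval 0 ≠ s ∧
        f.natDegree ≤ P.t ∧ ∃ j ∈ b.SV, j ∉ Zs ∧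
          f.eval (c.2.2.1 j : F) = (signPoly s c).eval (c.2.2.1 j : F) := by
  obtain ⟨k, hk⟩ := hx
  have hI := inv_run P Zs s c A r k
  obtain ⟨b, hb, h | ⟨hv, f, hf, rfl, B, hB, hBZ, hacc⟩⟩ := hI.output x hk
  · obtain ⟨b', -, h' | h'⟩ := hI.verdict_mem_casts _ (hI.verdictCast hS _ h)
    · exact absurd h'.1 (by simp)
    · simp only [Verdict.nok.injEq] at h'
      exact absurd h'.1 hne
  · have hval : Valid P s c b := by
      obtain ⟨b', hb', h' | h'⟩ := hI.verdict_mem_casts _ (hI.verdictCast hS _ hv)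
      · obtain rfl : b = b' := by simp_all
        exact h'.2
      · exact absurd h'.1 (by simp)
    -- A complaint at any time would refer to the same broadcast `b`, which is valid.
    refine ⟨fun l y hy => ?_, k, b, f, hb, hf, hval, hne, hI.revPoly_natDegree _ _ hf, ?_⟩
    · have h1 := (run_le P Zs s c A r (le_max_left k l)).maskedCast _ hb
      obtain ⟨b', hb', h' | h'⟩ := (inv_run P Zs s c A r (max k l)).verdict_mem_casts _
        ((run_le P Zs s c A r (le_max_right k l)).casts _ hy)
      · exact absurd h'.1 (by simp)
      · obtain rfl : b = b' := by simp_all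
        exact h'.2 hval
    · obtain ⟨j, h1, h2, h3⟩ := exists_honest_of_qCond hQ hval.2.1 hBZ hZs
      have hj : j ∈ b.SV := by simpa using h1
      have hjB : j ∈ B := by simpa [hj] using h2
      refine ⟨j, hj, h3, ?_⟩
      obtain ⟨q, hq, ha⟩ := hacc j hjB
      obtain rfl := hI.point hS j q (hI.revPoint j q hq h3)
      rcases ha with ha | ha
      · exact ha.symm
      · exact absurd (hval.2.2 j hj).symm ha

/-- Independence is obtained fibrewise. With everything but the honest evaluation points fixed, all
bad runs share the adversary's view, so one polynomial, chosen from any single bad run, has a root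
at an honest evaluation point in all of them. -/
theorem unforgeability [Fintype F] [DecidableEq F] (hQ : QCond 3 Finset.univ P.Z)
    (hZs : Zs ∈ P.Z) (hS : P.S ∉ Zs) (hI : P.I ∈ Zs) (hR : P.R ∉ Zs) (s : F) :
    prob {c : Coins n P.t F | ∃ s', Outputs P (run P Zs A r s c) s' ∧ s' ≠ s} ≤
      ENNReal.ofReal ((n * P.t : ℝ) / ((Fintype.card F : ℝ) - 1)) := by
  let N : Coins n P.t F → Coins n P.t F := fun c =>
    (c.1, c.2.1, fun j => if j ∈ Zs then c.2.2.1 j else 1, c.2.2.2)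
  have key (κ : Coins n P.t F) : ∃ ρ : Fin n → Finset Fˣ, (∀ j, (ρ j).card ≤ P.t) ∧
      (∀ j ∈ Zs, ρ j = ∅) ∧ ∀ c, N c = κ → (∃ s', Outputs P (run P Zs A r s c) s' ∧ s' ≠ s) →
        ∃ j, c.2.2.1 j ∈ ρ j := by
    -- A bad run in the fibre serves as reference and fixes `b` and `f`. Without one there is
    -- nothing to cover and empty sets suffice.
    by_cases hex : ∃ c₀, N c₀ = κ ∧ ∃ s', Outputs P (run P Zs A r s c₀) s' ∧ s' ≠ s
    · obtain ⟨c₀, rfl, x₀, hx₀, hne₀⟩ := hex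
      obtain ⟨hn₀, k₀, b, f, hb, hf, hval₀, hfs, hft, -⟩ :=
        exists_root_of_outputs_ne hQ hZs hS hx₀ hne₀
      have hroot : ∃ h : F[X], h ≠ 0 ∧ h.natDegree ≤ P.t ∧ ∀ c, N c = N c₀ →
          (∃ s', Outputs P (run P Zs A r s c) s' ∧ s' ≠ s) →
            ∃ j, j ∉ Zs ∧ h.eval (c.2.2.1 j : F) = 0 := by
        have hroots (c) (hc : N c = N c₀)
            (hbad : ∃ s', Outputs P (run P Zs A r s c) s' ∧ s' ≠ s) :
            signPoly s c = signPoly s c₀ ∧ maskPoly c = maskPoly c₀ ∧ Valid P s c b ∧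
              ∃ j ∈ b.SV, j ∉ Zs ∧
                f.eval (c.2.2.1 j : F) = (signPoly s c).eval (c.2.2.1 j : F) := by
          obtain ⟨x, hx, hne⟩ := hbad
          obtain ⟨hn, k, b', f', hb', hf', hval, -, -, hj⟩ :=
            exists_root_of_outputs_ne hQ hZs hS hx hne
          have h1 : c.1 = c₀.1 := congrArg (fun x => x.1) hc
          have h2 : c.2.1 = c₀.2.1 := congrArg (fun x => x.2.1) hc
          have h3 : c.2.2.2 = c₀.2.2.2 := congrArg (fun x => x.2.2.2) hc
          have h4 (j) (hj : j ∈ Zs) : c.2.2.1 j = c₀.2.2.1 j := by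
            have := congrFun (congrArg (fun x => x.2.2.1) hc) j
            simpa [N, hj] using this
          have hs : signPoly s c = signPoly s c₀ := by simp [signPoly, h1]
          have hm : maskPoly c = maskPoly c₀ := by simp [maskPoly, h2]
          have hcoup : Coupled P Zs s c₀ s c :=
            ⟨by simp [combiner, h3], by rw [hs, hm],
              fun j hj => by simp [verPoint, hs, hm, h4 j hj], fun _ => ⟨hs.symm, hm.symm⟩⟩
          -- Both runs are compared at a common time, where the broadcast and the revealed
          -- polynomial of each are still present and must coincide.
          have hsim := hcoup.run hS hR hn₀ hn (max k₀ k)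
          have e1 := (run_le P Zs s c₀ A r (le_max_left k₀ k)).maskedCast _ hb
          have e2 := (run_le P Zs s c A r (le_max_right k₀ k)).maskedCast _ hb'
          obtain rfl : b = b' := by
            rw [hsim.maskedCast, e2] at e1
            exact (Option.some.inj e1).symm
          have e3 := (run_le P Zs s c₀ A r (le_max_left k₀ k)).revPoly _ _ hf
          have e4 := (run_le P Zs s c A r (le_max_right k₀ k)).revPoly _ _ hf'
          obtain rfl : f = f' := by
            rw [(hsim.loc P.R hR).revPoly hI, e4] at e3
            exact (Option.some.inj e3).symm
          exact ⟨hs, hm, hval, hj⟩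
        -- The argument in the first case does not need this equality. In the second case $B-(dF+M)$
        -- serves as well: it is nonzero, and the signer's check makes it vanish at every
        -- supporter's point.
        by_cases hB : b.B = C b.d * signPoly s c₀ + maskPoly c₀
        · refine ⟨f - signPoly s c₀, fun h0 => hfs ?_, ?_, fun c hc hbad => ?_⟩
          · rw [sub_eq_zero.1 h0, signPoly_eval_zero]
          · exact (natDegree_sub_le _ _).trans (max_le hft (signPoly_natDegree_le s c₀))
          · obtain ⟨hs, -, -, j, -, hj, he⟩ := hroots c hc hbad
            exact ⟨j, hj, by rw [eval_sub, he, hs, sub_self]⟩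
        · refine ⟨b.B - (C b.d * signPoly s c₀ + maskPoly c₀), sub_ne_zero.2 hB, ?_,
            fun c hc hbad => ?_⟩
          · exact (natDegree_sub_le _ _).trans (max_le hval₀.1
              (natDegree_masked_le (signPoly_natDegree_le s c₀) (maskPoly_natDegree_le c₀)))
          · obtain ⟨hs, hm, hval, j, hjS, hj, -⟩ := hroots c hc hbad
            refine ⟨j, hj, ?_⟩
            have := hval.2.2 j hjS
            simp only [verPoint] at this
            simp [← this, hs, hm]
      obtain ⟨h, h0, ht, hh⟩ := hroot
      refine ⟨fun j => if j ∈ Zs then ∅ else Finset.univ.filter fun x : Fˣ => h.eval (x : F) = 0,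
        fun j => ?_, fun j hj => by simp [hj], fun c hc hbad => ?_⟩
      · dsimp only
        split_ifs
        · simp
        · exact card_units_roots_le h0 ht
      · obtain ⟨j, hj, he⟩ := hh c hc hbad
        exact ⟨j, by simp [hj, he]⟩
    · exact ⟨fun _ => ∅, by simp, by simp, fun c hc hbad => absurd ⟨c, hc, hbad⟩ hex⟩
  choose ρ hcard hempty hρ using key
  refine prob_le_of_resample (π := fun j c => c.2.2.1 j)
    (u := fun j g c => (c.1, c.2.1, Function.update c.2.2.1 j g, c.2.2.2))
    (ρ := fun c => ρ (N c)) (by simp) (by simp) (by simp) (fun j g c => ?_)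
    (fun c j => hcard _ j) fun c hc => hρ _ c rfl hc
  -- Resampling an honest point stays in the fibre of `N`; for a corrupt index the set of bad values
  -- is empty in every fibre.
  by_cases hj : j ∈ Zs
  · rw [hempty _ j hj, hempty _ j hj]
  · have : N (c.1, c.2.1, Function.update c.2.2.1 j g, c.2.2.2) = N c := by
      simp only [N, Prod.mk.injEq, true_and, and_true]
      funext i
      by_cases hi : i = j
      · simp [hi, hj]
      · simp [hi]
    rw [this]

end unforgeability

/-! ### Non-repudiation -/

section nonrepudiation

variable {P : Session n} {Zs : Finset (Fin n)} {s : F} {c c' : Coins n P.t F} {g : Config n F}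
  {A : Adversary n F} {r : A.Tape}

theorem Config.isSome_maskedCast_foldl_emit {i : Fin n} {l : List (Out n F)}
    (h : g.maskedCast.isSome ∨ ∃ m, .cast (.masked m) ∈ l) :
    (l.foldl (Config.emit Zs i) g).maskedCast.isSome := by
  induction l generalizing g with
  | nil => simpa using h
  | cons o l ih =>
    rw [List.foldl_cons]
    refine ih ?_
    rcases o with ⟨j, m⟩ | ⟨m | v⟩ <;> simp_all [Config.emit, Config.addCast]

theorem judge_of_ne {i : Fin n} (hi : i ≠ P.S) : judge P s c i = fun st => (st, []) := by
  funext st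
  unfold judge
  split
  · exact if_neg fun h => hi h.1
  · rfl

theorem react_fst_congr (i : Fin n) (x : PState n F × List (Out n F)) :
    (react P s c i x).1 = (react P s c' i x).1 := by
  rw [react_fst_eq, react_fst_eq]

/-- Away from the signer, the announcement is the only rule that reads a coin. So reactions agree
unless both runs announce. -/
theorem react_eq_or {i : Fin n} (hi : i ≠ P.S) (x : PState n F × List (Out n F)) :
    react P s c i x = react P s c' i x ∨
      (∃ m, .cast (.masked m) ∈ (react P s c i x).2) ∧
        ∃ m, .cast (.masked m) ∈ (react P s c' i x).2 := by
  have key : announce P c i x.1 = announce P c' i x.1 ∨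
      (∃ m, .cast (.masked m) ∈ (announce P c i x.1).2) ∧
        ∃ m, .cast (.masked m) ∈ (announce P c' i x.1).2 := by
    unfold announce
    split
    · split_ifs
      · exact .inr ⟨⟨_, List.mem_singleton_self _⟩, ⟨_, List.mem_singleton_self _⟩⟩
      · exact .inl rfl
    · exact .inl rfl
  rcases key with h | ⟨⟨m, hm⟩, m', hm'⟩
  · left
    simp only [react, judge_of_ne hi]
    simp only [andThen, h]
  · right
    simp only [react, andThen, List.mem_append]
    exact ⟨⟨m, by tauto⟩, m', by tauto⟩

theorem handle_eq_or {i : Fin n} (hi : i ≠ P.S) (x : PState n F × List (Out n F)) :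
    g.handle P Zs s c i x = g.handle P Zs s c' i x ∨
      (g.handle P Zs s c i x).maskedCast.isSome ∧ (g.handle P Zs s c' i x).maskedCast.isSome ∧
        (g.handle P Zs s c i x).loc = (g.handle P Zs s c' i x).loc := by
  rcases react_eq_or (s := s) (c := c) (c' := c') hi x with h | ⟨h, h'⟩
  · left
    simp only [Config.handle, h]
  · right
    refine ⟨Config.isSome_maskedCast_foldl_emit (.inr h),
      Config.isSome_maskedCast_foldl_emit (.inr h'), ?_⟩
    rw [handle_loc, handle_loc, react_fst_congr]

/-- Even the announcing move leaves the local states equal, because the combiner enters only the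
emitted message. -/
theorem apply_eq_or (hS : P.S ∈ Zs) (a : Action n F) :
    g.apply P Zs s c a = g.apply P Zs s c' a ∨
      (g.apply P Zs s c a).maskedCast.isSome ∧ (g.apply P Zs s c' a).maskedCast.isSome ∧
        (g.apply P Zs s c a).loc = (g.apply P Zs s c' a).loc := by
  have ne {i : Fin n} (hi : i ∉ Zs) : i ≠ P.S := fun h => hi (h ▸ hS)
  rcases a with k | ⟨src, dst, m⟩ | ⟨m | v⟩ | i | i | i | _ <;> simp only [Config.apply]
  · split
    · split_ifs with h
      · exact .inl rfl
      · exact handle_eq_or (ne fun h' => h (.inr h')) _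
    · exact .inl rfl
  · exact .inl trivial
  · exact .inl trivial
  · exact .inl trivial
  · split_ifs with h
    · exact .inl rfl
    · exact handle_eq_or (ne fun h' => h (.inl h')) _
  · split_ifs with h
    · exact .inl rfl
    · exact handle_eq_or (ne fun h' => h (.inl h')) _
  · split_ifs with h
    · exact .inl rfl
    · exact handle_eq_or (ne h) _
  · exact .inl trivial

/-- If the signer is corrupt, the coins have no influence until the intermediary announces the
masked polynomial. -/
theorem run_eq_or (hS : P.S ∈ Zs) (k : ℕ) :
    run P Zs A r s c k = run P Zs A r s c' k ∨
      ∃ j < k, (run P Zs A r s c (j + 1)).maskedCast.isSome ∧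
        (run P Zs A r s c' (j + 1)).maskedCast.isSome ∧
        (run P Zs A r s c (j + 1)).loc = (run P Zs A r s c' (j + 1)).loc := by
  induction k with
  | zero => simp [run, start, hS]
  | succ k ih =>
    rcases ih with h | ⟨j, hj, h⟩
    · rcases apply_eq_or (s := s) (c := c) (c' := c') (g := { run P Zs A r s c k with
        view := (run P Zs A r s c k).view ++ [.move (A.next r (run P Zs A r s c k).view)] }) hS
        (A.next r (run P Zs A r s c k).view) with h' | h'
      · left
        simp only [run, ← h]
        exact h'
      · right
        refine ⟨k, k.lt_succ_self, ?_⟩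
        simp only [run, ← h]
        exact h'
    · exact .inr ⟨j, hj.trans k.lt_succ_self, h⟩

/-- The party `j` holds a point that does not lie on the signing polynomial of the intermediary, but
this does not show when the combiner is `d`. -/
def Undetected (P : Session n) (L : Fin n → PState n F) (j : Fin n) (d : F) : Prop :=
  ∃ f h q, (L P.I).polys = some (f, h) ∧ (L j).point = some q ∧ q.v ≠ f.eval q.α ∧
    d * f.eval q.α + h.eval q.α = d * q.v + q.m

/-- Subtracting the two linear conditions gives $(d-d')(v-f(\alpha))=0$, and the second factor is
nonzero. -/
theorem Undetected.unique {L : Fin n → PState n F} {j : Fin n} {d d' : F}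
    (h : Undetected P L j d) (h' : Undetected P L j d') : d = d' := by
  obtain ⟨f, e, q, hp, hq, hne, heq⟩ := h
  obtain ⟨f', e', q', hp', hq', -, heq'⟩ := h'
  obtain ⟨rfl, rfl⟩ : f = f' ∧ e = e' := by simpa using hp.symm.trans hp'
  obtain rfl : q = q' := by simpa using hq.symm.trans hq'
  have : (d - d') * (q.v - f.eval q.α) = 0 := by linear_combination heq' - heq
  exact sub_eq_zero.1 ((mul_eq_zero.1 this).resolve_right (sub_ne_zero.2 hne))

/-- The contrapositive of liveness: a publicly announced value is always output, and otherwise a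
failure requires an honest supporter whose point is rejected. Rejection with $B=dF+M$ is exactly
`Undetected`. It is seen as soon as a broadcast is held, since honest supporters have their points
by then. -/
theorem exists_undetected (hZ : IsLowerSet (P.Z : Set (Finset (Fin n)))) (hZs : Zs ∈ P.Z)
    (hI : P.I ∉ Zs) (hR : P.R ∉ Zs) (hE : EventualDelivery Zs (run P Zs A r s c))
    (hr : RevealInvoked Zs (run P Zs A r s c)) {σ : ICSig F}
    (hσ : SetsICSig P (run P Zs A r s c) σ) (hn : ¬ Outputs P (run P Zs A r s c) σ.value) :
    (∃ k, (run P Zs A r s c k).maskedCast.isSome) ∧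
      ∀ k, (run P Zs A r s c k).maskedCast.isSome →
        ∃ j, Undetected P (run P Zs A r s c k).loc j (combiner c) := by
  obtain ⟨k, hk⟩ := hσ
  have hi := inv_run P Zs s c A r k
  unfold PState.icSig at hk
  split at hk
  · rename_i b x hb hv
    obtain rfl : ICSig.secret x = σ := by simpa using hk
    exact absurd (outputs_secret hR hE hr ⟨k, hi.masked _ _ hb⟩ ⟨k, hi.verdict _ _ hv⟩) hn
  · rename_i b hb hv
    rw [if_pos rfl, Option.map_eq_some_iff] at hk
    obtain ⟨⟨f, h⟩, hp, rfl⟩ := hk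
    have hb := hi.masked _ _ hb
    refine ⟨⟨k, by simp [hb]⟩, fun l hl => ?_⟩
    by_contra hno
    refine hn (outputs_poly hZ hZs hI hR hE hr ⟨k, hb⟩ ⟨k, hi.verdict _ _ hv⟩ ⟨k, hp⟩
      fun j hj hjZ => ?_)
    have hil := inv_run P Zs s c A r l
    obtain ⟨b', hb'⟩ := Option.isSome_iff_exists.1 hl
    have e1 := (run_le P Zs s c A r (le_max_left k l)).maskedCast _ hb
    have e2 := (run_le P Zs s c A r (le_max_right k l)).maskedCast _ hb'
    obtain rfl : b = b' := by simpa using e1.symm.trans e2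
    obtain ⟨f', h', hp', hd, hB, -, hpt⟩ := hil.maskedCast hI b hb'
    have e3 := (run_le P Zs s c A r (le_max_left k l)).polys _ _ hp
    have e4 := (run_le P Zs s c A r (le_max_right k l)).polys _ _ hp'
    obtain ⟨rfl, rfl⟩ : f = f' ∧ h = h' := by simpa using e3.symm.trans e4
    obtain ⟨q, hq⟩ := Option.isSome_iff_exists.1 (hpt j hj hjZ)
    refine ⟨q, ⟨l, hq⟩, ?_⟩
    by_contra hacc
    simp only [Accepts, not_or, not_not, hB, hd] at hacc
    exact hno ⟨j, f, h, q, hp', hq, hacc.1, by simpa using hacc.2⟩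
  · simp at hk

/-- The local states when the broadcast first appears are the same in all bad runs, so the bad
combiners come from one table that does not depend on the combiner. -/
theorem nonrepudiation [Fintype F] [DecidableEq F]
    (hZ : IsLowerSet (P.Z : Set (Finset (Fin n)))) (hZs : Zs ∈ P.Z)
    (hS : P.S ∈ Zs) (hI : P.I ∉ Zs) (hR : P.R ∉ Zs) (s : F) :
    prob {c : Coins n P.t F | EventualDelivery Zs (run P Zs A r s c) ∧
        RevealInvoked Zs (run P Zs A r s c) ∧ ∃ σ, SetsICSig P (run P Zs A r s c) σ ∧
          ¬ Outputs P (run P Zs A r s c) σ.value} ≤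
      ENNReal.ofReal ((n * P.t : ℝ) / ((Fintype.card F : ℝ) - 1)) := by
  classical
  -- Each party rules out at most one combiner; this weakens the resulting bound from $n$ to $nt$ in
  -- the numerator.
  have ht : 1 ≤ P.t :=
    (Finset.card_pos.2 ⟨_, hS⟩).trans_le (Finset.le_sup (f := Finset.card) hZs)
  set E := {c : Coins n P.t F | EventualDelivery Zs (run P Zs A r s c) ∧
        RevealInvoked Zs (run P Zs A r s c) ∧ ∃ σ, SetsICSig P (run P Zs A r s c) σ ∧
          ¬ Outputs P (run P Zs A r s c) σ.value}
  have bad {c} (hc : c ∈ E) : (∃ k, (run P Zs A r s c k).maskedCast.isSome) ∧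
      ∀ k, (run P Zs A r s c k).maskedCast.isSome →
        ∃ j, Undetected P (run P Zs A r s c k).loc j (combiner c) := by
    obtain ⟨hE, hr, σ, hσ, hn⟩ := hc
    exact exists_undetected hZ hZs hI hR hE hr hσ hn
  have key : ∃ L : Fin n → PState n F, ∀ c ∈ E, ∃ j, Undetected P L j (combiner c) := by
    by_cases hex : ∃ c₀, c₀ ∈ E
    · obtain ⟨c₀, hc₀⟩ := hex
      have h₀ := (bad hc₀).1
      -- The table is read off a reference bad run at the first time it holds a broadcast. Another
      -- run either still coincides with it then, or departed from it at an announcing move, which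
      -- by minimality was the move just made.
      refine ⟨(run P Zs A r s c₀ (Nat.find h₀)).loc, fun c hc => ?_⟩
      rcases run_eq_or (A := A) (r := r) (s := s) (c := c₀) (c' := c) hS (Nat.find h₀) with
        h | ⟨j, hj, h1, h2, h3⟩
      · rw [h]
        exact (bad hc).2 _ (h ▸ Nat.find_spec h₀)
      · have hj' : j + 1 = Nat.find h₀ := le_antisymm hj (Nat.find_min' h₀ h1)
        rw [← hj', h3]
        exact (bad hc).2 _ h2
    · exact ⟨fun _ => PState.initial n F, fun c hc => absurd ⟨c, hc⟩ hex⟩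
  obtain ⟨L, hL⟩ := key
  refine prob_le_of_resample (π := fun _ c => c.2.2.2)
    (u := fun _ g c => (c.1, c.2.1, c.2.2.1, g))
    (ρ := fun _ j => Finset.univ.filter fun d : Fˣ => Undetected P L j (d : F))
    (by simp) (by simp) (by simp) (by simp) (fun _ j => ?_) fun c hc => ?_
  · refine (Finset.card_le_one.2 fun d hd d' hd' => ?_).trans ht
    simp only [Finset.mem_filter, Finset.mem_univ, true_and] at hd hd'
    exact Units.ext (hd.unique hd')
  · obtain ⟨j, hj⟩ := hL c hc
    exact ⟨j, Finset.mem_filter.2 ⟨Finset.mem_univ _, hj⟩⟩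

end nonrepudiation

/-! ### Communication -/

section complexity

variable {P : Session n} {Zs : Finset (Fin n)} {s : F} {c : Coins n P.t F} {g g' : Config n F}
  {t : ℕ}

open Classical in
theorem authBits_concat {p : Packet n F} (h : g'.packets = g.packets ++ [p]) :
    authBits t Zs g' = authBits t Zs g +
      if p.src ∉ Zs ∧ p.msg.kind.IsAuth then p.msg.bits t else 0 := by
  simp only [authBits, h, List.filter_append, List.map_append, List.sum_append]
  split_ifs with hp <;> simp [hp]

open Classical in
theorem revealBits_concat {p : Packet n F} (h : g'.packets = g.packets ++ [p]) :
    revealBits t Zs g' = revealBits t Zs g +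
      if p.src ∉ Zs ∧ ¬ p.msg.kind.IsAuth then p.msg.bits t else 0 := by
  simp only [revealBits, h, List.filter_append, List.map_append, List.sum_append]
  split_ifs with hp <;> simp [hp]

theorem authBits_congr (h : g'.packets = g.packets) : authBits t Zs g' = authBits t Zs g := by
  rw [authBits, authBits, h]

theorem revealBits_congr (h : g'.packets = g.packets) :
    revealBits t Zs g' = revealBits t Zs g := by
  rw [revealBits, revealBits, h]

open Classical in
/-- The communication that has taken place, in terms of the steps carried out. -/
structure CostInv (P : Session n) (Zs : Finset (Fin n)) (g : Config n F) : Prop where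
  auth : authBits P.t Zs g ≤ 3 + 2 * ((P.t + 1) * elemBits F) + n * (3 + 3 * elemBits F) +
    3 * (Finset.univ.filter fun i => (g.loc i).point.isSome).card
  reveal : revealBits P.t Zs g ≤
    (if (g.loc P.I).polySent then 3 + (P.t + 1) * elemBits F else 0) +
      (3 + 3 * elemBits F) * (Finset.univ.filter fun i => (g.loc i).pointSent).card
  casts_length : g.casts.length ≤
    (if (g.loc P.I).announced then 1 else 0) + (if (g.loc P.S).judged then 1 else 0)
  casts_natDegree : ∀ m, .masked m ∈ g.casts → m.B.natDegree ≤ P.t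

theorem polyBits_of_natDegree_le {f : F[X]} (h : f.natDegree ≤ t) :
    polyBits t f = (t + 1) * elemBits F := by
  rw [polyBits, max_eq_left h]

theorem costInv_start : CostInv P Zs (start P Zs s c) := by
  classical
  obtain ⟨v, hv⟩ := start_eq P Zs s c
  rw [hv]
  constructor
  · refine le_trans ?_ (Nat.le_add_right _ _)
    by_cases hS : P.S ∈ Zs
    · simp [authBits, hS]
    · have h : ((initialPackets P s c).map fun p => p.msg.bits P.t).sum =
          3 + 2 * ((P.t + 1) * elemBits F) + n * (3 + 3 * elemBits F) := by
        simp [initialPackets, Msg.bits, polyBits_of_natDegree_le, signPoly_natDegree_le,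
          maskPoly_natDegree_le, Function.comp_def, two_mul]
      simp only [authBits, if_neg hS]
      exact ((List.filter_sublist.map _).sum_le_sum (by simp)).trans h.le
  · have : ∀ p ∈ (if P.S ∈ Zs then [] else initialPackets P s c), p.msg.kind.IsAuth := by
      intro p hp
      split_ifs at hp
      · simp at hp
      · simp only [initialPackets, List.mem_cons, List.mem_map] at hp
        rcases hp with rfl | ⟨j, -, rfl⟩ <;> trivial
    have : revealBits P.t Zs (⟨fun _ => PState.initial n F,
        if P.S ∈ Zs then [] else initialPackets P s c, ∅, none, none, [], v⟩ : Config n F) = 0 := by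
      simp only [revealBits]
      rw [List.filter_eq_nil_iff.2 fun p hp => by simp [this p hp]]
      rfl
    rw [this]
    exact Nat.zero_le _
  · simp
  · simp

theorem Step.casts_eq_or (h : Step P Zs s c g g') :
    (g'.casts = g.casts ∧ (∀ i, (g'.loc i).announced = (g.loc i).announced) ∧
      ∀ i, (g'.loc i).judged = (g.loc i).judged) ∨
    ((∃ m, g'.casts = g.casts ++ [.masked m] ∧
        ∃ f h d, m.B = C d * f + h ∧ (g.loc P.I).polys = some (f, h)) ∧
      ¬ (g.loc P.I).announced ∧ (g'.loc P.I).announced ∧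
      ∀ i, (g'.loc i).judged = (g.loc i).judged) ∨
    ((∃ v, g'.casts = g.casts ++ [.verdict v]) ∧ ¬ (g.loc P.S).judged ∧ (g'.loc P.S).judged ∧
      ∀ i, (g'.loc i).announced = (g.loc i).announced) := by
  cases h
  case announce f h v hI hp ha hc =>
    exact .inr (.inl ⟨⟨_, rfl, f, h, _, rfl, hp⟩, ha, by simp, by grind [Function.update_apply]⟩)
  case judge b x v hS hb hj hx =>
    exact .inr (.inr ⟨⟨_, rfl⟩, hj, by simp, by grind [Function.update_apply]⟩)
  all_goals
    exact .inl ⟨rfl, by grind [Function.update_apply], by grind [Function.update_apply]⟩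

/-- The packets sent in a step. -/
theorem Step.packets_eq_or (h : Step P Zs s c g g') :
    ((g'.packets = g.packets ∨ ∃ p, p.src ∈ Zs ∧ g'.packets = g.packets ++ [p]) ∧
      (∀ i, (g'.loc i).polySent = (g.loc i).polySent) ∧
      ∀ i, (g'.loc i).pointSent = (g.loc i).pointSent) ∨
    (∃ j, g'.packets = g.packets ++ [⟨j, P.I, .received⟩] ∧ (g.loc j).point = none ∧
      (g'.loc j).point.isSome ∧ (∀ i, (g'.loc i).polySent = (g.loc i).polySent) ∧
      ∀ i, (g'.loc i).pointSent = (g.loc i).pointSent) ∨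
    (∃ f h, g'.packets = g.packets ++ [⟨P.I, P.R, .revealPoly f⟩] ∧
      (g.loc P.I).polys = some (f, h) ∧ ¬ (g.loc P.I).polySent ∧ (g'.loc P.I).polySent ∧
      ∀ i, (g'.loc i).pointSent = (g.loc i).pointSent) ∨
    (∃ j q, g'.packets = g.packets ++ [⟨j, P.R, .revealPoint q⟩] ∧
      ¬ (g.loc j).pointSent ∧ (∀ i, (g'.loc i).pointSent = ((g.loc i).pointSent ∨ i = j)) ∧
      ∀ i, (g'.loc i).polySent = (g.loc i).polySent) := by
  cases h
  case inject p hp => exact .inl ⟨.inr ⟨p, hp, rfl⟩, fun _ => rfl, fun _ => rfl⟩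
  case recvPoint k j q v hp hj hn =>
    exact .inr (.inl ⟨j, rfl, hn, by simp, by grind [Function.update_apply],
      by grind [Function.update_apply]⟩)
  case sendPoly f h v hI hp hs =>
    exact .inr (.inr (.inl ⟨f, h, rfl, hp, hs, by simp, by grind [Function.update_apply]⟩))
  case sendPoint j q v hj hp hs =>
    exact .inr (.inr (.inr ⟨j, q, rfl, hs, by grind [Function.update_apply],
      by grind [Function.update_apply]⟩))
  all_goals
    exact .inl ⟨.inl rfl, by grind [Function.update_apply], by grind [Function.update_apply]⟩

/-- An amortized count: every step in which an honest party sends or broadcasts also sets a flag or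
fills a point that was unset, and the right-hand side grows by at least the cost. -/
theorem Step.costInv (hI : Inv P Zs s c g) (hg : CostInv P Zs g) (h : Step P Zs s c g g') :
    CostInv P Zs g' := by
  classical
  have hle := h.le hI
  have hsub : (Finset.univ.filter fun i => (g.loc i).point.isSome) ⊆
      Finset.univ.filter fun i => (g'.loc i).point.isSome := by
    intro i hi
    simp only [Finset.mem_filter, Finset.mem_univ, true_and] at hi ⊢
    obtain ⟨q, hq⟩ := Option.isSome_iff_exists.1 hi
    simp [hle.point i q hq]
  have hcard := Finset.card_le_card hsub
  have ha := hg.auth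
  have hr := hg.reveal
  constructor
  · rcases h.packets_eq_or with ⟨hp | ⟨p, hpZ, hp⟩, -⟩ | ⟨j, hp, h1, h2, -⟩ | ⟨f, e, hp, -⟩ |
      ⟨j, q, hp, -⟩
    · rw [authBits_congr hp]
      omega
    · rw [authBits_concat hp, if_neg fun h => h.1 hpZ]
      omega
    · have : (Finset.univ.filter fun i => (g.loc i).point.isSome).card <
          (Finset.univ.filter fun i => (g'.loc i).point.isSome).card :=
        Finset.card_lt_card (Finset.ssubset_iff_of_subset hsub |>.2 ⟨j, by simp [h2], by simp [h1]⟩)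
      have hb : (if j ∉ Zs ∧ (Msg.received : Msg F).kind.IsAuth then
          (Msg.received : Msg F).bits P.t else 0) ≤ 3 := by
        split_ifs <;> simp [Msg.bits]
      rw [authBits_concat hp]
      simp only at hb ⊢
      omega
    · rw [authBits_concat hp, if_neg fun h => h.2]
      omega
    · rw [authBits_concat hp, if_neg fun h => h.2]
      omega
  · rcases h.packets_eq_or with ⟨hp | ⟨p, hpZ, hp⟩, h1, h2⟩ | ⟨j, hp, -, -, h1, h2⟩ |
      ⟨f, e, hp, hf, h1, h2, h3⟩ | ⟨j, q, hp, h1, h2, h3⟩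
    · simpa only [revealBits_congr hp, h1, h2] using hr
    · rw [revealBits_concat hp, if_neg fun h => h.1 hpZ, add_zero]
      simpa only [h1, h2] using hr
    · rw [revealBits_concat hp, if_neg fun h => h.2 trivial, add_zero]
      simpa only [h1, h2] using hr
    · rw [if_neg h1] at hr
      rw [revealBits_concat hp, if_pos h2]
      simp only [h3]
      have : (if P.I ∉ Zs ∧ ¬ (Msg.revealPoly f).kind.IsAuth then
          (Msg.revealPoly f).bits P.t else 0) ≤ 3 + (P.t + 1) * elemBits F := by
        split_ifs
        · simp [Msg.bits, polyBits_of_natDegree_le (hI.polys_natDegree _ _ _ hf).1]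
        · exact Nat.zero_le _
      omega
    · rw [revealBits_concat hp, h3]
      have hins : (Finset.univ.filter fun i => (g'.loc i).pointSent) =
          insert j (Finset.univ.filter fun i => (g.loc i).pointSent) := by
        ext i
        simp [h2, or_comm]
      rw [hins, Finset.card_insert_of_notMem (by simp [h1])]
      have : (if j ∉ Zs ∧ ¬ (Msg.revealPoint q).kind.IsAuth then
          (Msg.revealPoint q).bits P.t else 0) ≤ 3 + 3 * elemBits F := by
        split_ifs <;> simp [Msg.bits]
      rw [mul_add, mul_one]
      simp only at this ⊢
      omega
  · have hc := hg.casts_length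
    rcases h.casts_eq_or with ⟨h1, h2, h3⟩ | ⟨⟨m, h1, -⟩, h2, h3, h4⟩ | ⟨⟨v, h1⟩, h2, h3, h4⟩
    · simpa only [h1, h2, h3] using hc
    · rw [if_neg h2] at hc
      rw [h1, if_pos h3, h4, List.length_append, List.length_singleton]
      omega
    · rw [if_neg h2] at hc
      rw [h1, if_pos h3, h4, List.length_append, List.length_singleton]
      omega
  · have hc := hg.casts_natDegree
    intro m hm
    rcases h.casts_eq_or with ⟨h1, -⟩ | ⟨⟨m', h1, f, e, d, hB, hp⟩, -⟩ | ⟨⟨v, h1⟩, -⟩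
    · exact hc m (h1 ▸ hm)
    · rw [h1, List.mem_append, List.mem_singleton] at hm
      rcases hm with hm | hm
      · exact hc m hm
      · obtain rfl : m = m' := by simpa using hm
        have := hI.polys_natDegree _ _ _ hp
        exact hB ▸ natDegree_masked_le this.1 this.2
    · rw [h1, List.mem_append, List.mem_singleton] at hm
      exact hc m (hm.resolve_right (by simp))

theorem Steps.costInv (hI : Inv P Zs s c g) (hg : CostInv P Zs g) (h : Steps P Zs s c g g') :
    CostInv P Zs g' := by
  induction h with
  | refl => exact hg
  | tail h' h ih => exact h.costInv (Steps.inv_le hI h').1 ih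

/-- A field has at least two elements, so the rounding error of at most one bit is absorbed by
doubling the logarithm. -/
theorem elemBits_le_logb [Fintype F] :
    (elemBits F : ℝ) ≤ 2 * Real.logb 2 (Fintype.card F) ∧ 1 ≤ elemBits F := by
  have hq : 1 < Fintype.card F := Fintype.one_lt_card
  have h1 : (Nat.log 2 (Fintype.card F) : ℝ) ≤ Real.logb 2 (Fintype.card F) := by
    simpa using Real.natLog_le_logb (Fintype.card F) 2
  have h2 : 1 ≤ Nat.log 2 (Fintype.card F) := Nat.log_pos one_lt_two hq
  have h3 : Nat.clog 2 (Fintype.card F) ≤ Nat.log 2 (Fintype.card F) + 1 :=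
    Nat.clog_le_of_le_pow (Nat.lt_pow_succ_log_self one_lt_two _).le
  have h2' : (1 : ℝ) ≤ Nat.log 2 (Fintype.card F) := by exact_mod_cast h2
  have h3' : (Nat.clog 2 (Fintype.card F) : ℝ) ≤ Nat.log 2 (Fintype.card F) + 1 := by
    exact_mod_cast h3
  rw [elemBits, Nat.card_eq_fintype_card]
  exact ⟨by linarith, Nat.clog_pos one_lt_two hq⟩

theorem communication [Fintype F] (A : Adversary n F) (r : A.Tape) (k : ℕ) :
    (authBits P.t Zs (run P Zs A r s c k) : ℝ) ≤
        (32 : ℕ) * (n * Real.logb 2 (Fintype.card F)) ∧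
      (run P Zs A r s c k).casts.length ≤ 32 ∧
      (∀ b ∈ (run P Zs A r s c k).casts,
        (b.bits P.t : ℝ) ≤ (32 : ℕ) * (n * Real.logb 2 (Fintype.card F))) ∧
      (revealBits P.t Zs (run P Zs A r s c k) : ℝ) ≤
        (32 : ℕ) * (n * Real.logb 2 (Fintype.card F)) := by
  classical
  have hC := Steps.costInv (inv_start P Zs s c) costInv_start
    (steps_run P Zs s c A r (Nat.zero_le k))
  obtain ⟨he, he1⟩ := elemBits_le_logb (F := F)
  have hn : 1 ≤ n := P.S.pos
  have ht : P.t ≤ n := Finset.sup_le fun Z _ => card_finset_fin_le Z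
  -- The constant 16 is set by authentication: $3+4+6+3$ for the fixed bits, the two polynomials,
  -- the points and the confirmations. Passing from `elemBits` to the logarithm doubles it to 32.
  have fin {m : ℕ} (h : m ≤ 16 * (n * elemBits F)) :
      (m : ℝ) ≤ (32 : ℕ) * (n * Real.logb 2 (Fintype.card F)) := by
    have h' : (m : ℝ) ≤ 16 * (n * elemBits F) := by exact_mod_cast h
    refine h'.trans ?_
    have := mul_le_mul_of_nonneg_left he (Nat.cast_nonneg (α := ℝ) n)
    push_cast
    linarith
  have h1 : elemBits F ≤ n * elemBits F := Nat.le_mul_of_pos_left _ hn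
  have h2 : n ≤ n * elemBits F := Nat.le_mul_of_pos_right _ he1
  have h3 : (P.t + 1) * elemBits F ≤ 2 * (n * elemBits F) := by
    rw [add_mul, one_mul, two_mul]
    exact Nat.add_le_add (Nat.mul_le_mul_right _ ht) h1
  have h4 : n * (3 + 3 * elemBits F) ≤ 6 * (n * elemBits F) := by
    rw [mul_add]
    nlinarith
  have hcard (p : Fin n → Prop) [DecidablePred p] : (Finset.univ.filter p).card ≤ n :=
    card_finset_fin_le _
  refine ⟨fin ?_, ?_, fun b hb => fin ?_, fin ?_⟩
  · have := hcard fun i => ((run P Zs A r s c k).loc i).point.isSome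
    have := hC.auth
    omega
  · have := hC.casts_length
    split_ifs at this <;> omega
  · rcases b with m | _ | x
    · have := hC.casts_natDegree m hb
      simp only [Cast.bits, polyBits_of_natDegree_le this]
      omega
    · simp only [Cast.bits]
      omega
    · simp only [Cast.bits]
      omega
  · have h5 := Nat.mul_le_mul_left (3 + 3 * elemBits F)
      (hcard fun i => ((run P Zs A r s c k).loc i).pointSent)
    rw [mul_comm _ n] at h5
    have := hC.reveal
    split_ifs at this <;> omega

end complexity

end AICP

/-! ### The five properties together, with constant 32 -/

theorem mainTheorem8 :
    ∃ K : ℕ, ∀ (n : ℕ) (F : Type*) [Field F] [Fintype F] [DecidableEq F] (P : AICP.Session n)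
      (Zs : Finset (Fin n)) (A : AICP.Adversary n F) (r : A.Tape),
      IsLowerSet (P.Z : Set (Finset (Fin n))) → AICP.QCond 3 Finset.univ P.Z → Zs ∈ P.Z →
      -- correctness
      (P.S ∉ Zs → P.I ∉ Zs → P.R ∉ Zs →
        ∀ (s : F) (c : AICP.Coins n P.t F),
          AICP.EventualDelivery Zs (AICP.run P Zs A r s c) →
          AICP.AllAuthComplete Zs (AICP.run P Zs A r s c) ∧
          (AICP.RevealInvoked Zs (AICP.run P Zs A r s c) →
            AICP.Outputs P (AICP.run P Zs A r s c) s)) ∧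
      -- privacy
      (P.S ∉ Zs → P.I ∉ Zs → P.R ∉ Zs →
        ∀ s s' : F,
          (AICP.coinDist n P.t F).map (fun c k => (AICP.run P Zs A r s c k).view) =
          (AICP.coinDist n P.t F).map (fun c k => (AICP.run P Zs A r s' c k).view)) ∧
      -- unforgeability
      (P.S ∉ Zs → P.R ∉ Zs → P.I ∈ Zs →
        ∀ s : F,
          AICP.prob {c : AICP.Coins n P.t F |
            ∃ s', AICP.Outputs P (AICP.run P Zs A r s c) s' ∧ s' ≠ s} ≤
          ENNReal.ofReal ((n * P.t : ℝ) / ((Fintype.card F : ℝ) - 1))) ∧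
      -- non-repudiation
      (P.S ∈ Zs → P.I ∉ Zs → P.R ∉ Zs →
        ∀ s : F,
          AICP.prob {c : AICP.Coins n P.t F |
            AICP.EventualDelivery Zs (AICP.run P Zs A r s c) ∧
            AICP.RevealInvoked Zs (AICP.run P Zs A r s c) ∧
            ∃ σ, AICP.SetsICSig P (AICP.run P Zs A r s c) σ ∧
              ¬ AICP.Outputs P (AICP.run P Zs A r s c) σ.value} ≤
          ENNReal.ofReal ((n * P.t : ℝ) / ((Fintype.card F : ℝ) - 1))) ∧
      -- communication
      (∀ (s : F) (c : AICP.Coins n P.t F) (k : ℕ),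
        (AICP.authBits P.t Zs (AICP.run P Zs A r s c k) : ℝ) ≤
          K * (n * Real.logb 2 (Fintype.card F)) ∧
        (AICP.run P Zs A r s c k).casts.length ≤ K ∧
        (∀ b ∈ (AICP.run P Zs A r s c k).casts,
          (b.bits P.t : ℝ) ≤ K * (n * Real.logb 2 (Fintype.card F))) ∧
        (AICP.revealBits P.t Zs (AICP.run P Zs A r s c k) : ℝ) ≤
          K * (n * Real.logb 2 (Fintype.card F))) := by
  refine ⟨32, fun n F _ _ _ P Zs A r hZ hQ hZs => ⟨fun hS hI hR s c hE => ?_,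
    fun hS hI hR s s' => ?_, fun hS hR hI s => ?_, fun hS hI hR s => ?_, fun s c k => ?_⟩⟩
  · exact AICP.correctness hZ hZs hS hI hR hE
  · exact AICP.privacy hZs hS hI hR s s'
  · exact AICP.unforgeability hQ hZs hS hI hR s
  · exact AICP.nonrepudiation hZ hZs hS hI hR s
  · exact AICP.communication A r k
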